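/- **Conventions.** First-order. Let $\mathcal L'$ be a first-order language. For $\mathcal L'$-structures $A,B$ let $\binom{B}{A}$ be the set of embeddings of $A$ into $B$. For a natural number $r$ write $C\to(B)^A_r$ if for every colouring $\chi:\binom{C}{A}\to\{0,\dots,r-1\}$ there is $f\in\binom{C}{B}$ such that $\chi$ is constant on $\{f\circ g: g\in\binom{B}{A}\}$. A class $\mathcal C$ of finite $\mathcal L'$-structures has the *embedding Ramsey property* if for all $A,B\in\mathcal C$ such that $A$ embeds into $B$ and every $r\in\mathbb N$ there is $C\in\mathcal C$, into which $B$ embeds, with $C\to(B)^A_r$. A structure $\mathcal I$ is *locally finite* if every finite subset generates a finite substructure; $\mathrm{age}(\mathcal I)$ is the class of finitely generated structures that embed into $\mathcal I$. Continuous logic. A continuous signature $\mathcal L$ consists of function and predicate symbols of finite arity with a uniform continuity modulus for each argument; $\mathcal L$-structures are nonempty complete metric spaces with metric bounded by $1$, with interpretations of the function symbols and $[0,1]$-valued interpretations of the predicate symbols respecting the moduli. Formulas are built from atomic formulas (including the distance) by all continuous connectives $[0,1]^k\to[0,1]$ and the quantifiers $\sup$, $\inf$. A theory is a consistent set of conditions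 $\varphi=0$ with $\varphi$ a sentence; it is complete if its set of consequences is maximal. A monster model $\mathfrak C$ of a complete theory $T$ is a model that is $\kappa$-saturated and strongly $\kappa$-homogeneous (every elementary map between subsets of cardinality less than $\kappa$ extends to an automorphism), for a strong limit cardinal $\kappa>|\mathcal L|+\aleph_0$; index structures are always assumed to have cardinality less than $\kappa$. A CL-formula in $n$ variables is a continuous function $\varphi:S_n(\emptyset)\to\mathbb R$ on the space of complete $n$-types of $T$, and $\varphi(\bar a):=\varphi(\mathrm{tp}(\bar a))$. Let $\mathcal I$ be an $\mathcal L'$-structure and $(a_i)_{i\in\mathcal I}$, $(b_i)_{i\in\mathcal I}$ sequences of elements of $\mathfrak C$. The sequence $(b_i)$ is *$\mathcal I$-indiscernible* if for all $n$ and all $n$-tuples $\bar\imath,\bar\jmath$ from $\mathcal I$ with the same quantifier-free $\mathcal L'$-type, $\mathrm{tp}(b_{\bar\imath})=\mathrm{tp}(b_{\bar\jmath})$. It is *locally based on* $(a_i)$ if for every $n$, every finite set $\Delta$ of CL-formulas in $n$ variables, every $n$-tuple $\bar\jmath$ from $\mathcal I$ and every $\varepsilon>0$ there is an $n$-tuple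 $\bar\imath$ from $\mathcal I$ with the same quantifier-free type as $\bar\jmath$ such that $|\varphi(b_{\bar\jmath})-\varphi(a_{\bar\imath})|\le\varepsilon$ for all $\varphi\in\Delta$. *$\mathcal I$-indexed indiscernibles have the continuous modelling property in $T$* if for every $\mathcal I$-indexed sequence in a monster model $\mathfrak C$ of $T$ there is an $\mathcal I$-indiscernible sequence $(b_i)_{i\in\mathcal I}$ in $\mathfrak C$ that is locally based on it. **Theorem.** Let $\mathcal L'$ be a first-order language and let $\mathcal I$ be an infinite, locally finite $\mathcal L'$-structure. Then the following are equivalent: 1. $\mathrm{age}(\mathcal I)$ has the embedding Ramsey property. 2. $\mathcal I$-indexed indiscernibles have the continuous modelling property in every complete continuous-logic theory $T$ (in every continuous signature). -/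

import Mathlib

open CategoryTheory
open scoped FirstOrder

universe u v w x y

noncomputable section

namespace ContinuousModelTheory

/-! ### Continuous logic: signatures, structures, formulas, theories -/

/-- A continuous (metric) signature: function and predicate symbols of each finite arity, and for
every symbol and every argument place a uniform continuity modulus. The distance symbol is built
into the formulas below. -/
structure MetricSignature where
  Functions : ℕ → Type u
  Predicates : ℕ → Type u
  funModulus : ∀ {n : ℕ}, Functions n → Fin n → ℝ → ℝ
  funModulus_pos : ∀ {n : ℕ} (f : Functions n) (i : Fin n) (ε : ℝ), 0 < ε → 0 < funModulus f i ε
  predModulus : ∀ {n : ℕ}, Predicates n → Fin n → ℝ → ℝ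
  predModulus_pos : ∀ {n : ℕ} (P : Predicates n) (i : Fin n) (ε : ℝ),
    0 < ε → 0 < predModulus P i ε

namespace MetricSignature

/-- The number of symbols of the signature, plus `ℵ₀`. -/
def card (L : MetricSignature.{u}) : Cardinal.{u} :=
  Cardinal.mk (Σ n, L.Functions n) + Cardinal.mk (Σ n, L.Predicates n) + Cardinal.aleph0

/-- A continuous `L`-structure: a nonempty complete metric space of diameter at most `1` with
interpretations of the symbols that respect the prescribed moduli in every argument place. -/
class Structure (L : MetricSignature.{u}) (M : Type v) [MetricSpace M] where
  nonempty : Nonempty M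
  complete : CompleteSpace M
  dist_le_one : ∀ a b : M, dist a b ≤ 1
  funMap : ∀ {n : ℕ}, L.Functions n → (Fin n → M) → M
  predMap : ∀ {n : ℕ}, L.Predicates n → (Fin n → M) → unitInterval
  funMap_modulus : ∀ {n : ℕ} (f : L.Functions n) (i : Fin n) (ε : ℝ), 0 < ε →
    ∀ (a : Fin n → M) (z t : M), dist z t < L.funModulus f i ε →
      dist (funMap f (Function.update a i z)) (funMap f (Function.update a i t)) ≤ ε
  predMap_modulus : ∀ {n : ℕ} (P : L.Predicates n) (i : Fin n) (ε : ℝ), 0 < ε →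
    ∀ (a : Fin n → M) (z t : M), dist z t < L.predModulus P i ε →
      dist (predMap P (Function.update a i z)) (predMap P (Function.update a i t)) ≤ ε

/-- Terms with variables from `α`. -/
inductive Term (L : MetricSignature.{u}) (α : Type v) : Type (max u v)
  | var : α → Term L α
  | func {n : ℕ} : L.Functions n → (Fin n → Term L α) → Term L α

/-- Formulas with free variables from `α` and, in addition, `n` variables that are available for
quantification. Every continuous `u : [0,1]^k → [0,1]` is a connective. -/
inductive BoundedFormula (L : MetricSignature.{u}) (α : Type v) : ℕ → Type (max u v)
  | dist {n : ℕ} : L.Term (α ⊕ Fin n) → L.Term (α ⊕ Fin n) → BoundedFormula L α n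
  | pred {n k : ℕ} : L.Predicates k → (Fin k → L.Term (α ⊕ Fin n)) → BoundedFormula L α n
  | conn {n k : ℕ} : C(Fin k → unitInterval, unitInterval) → (Fin k → BoundedFormula L α n) →
      BoundedFormula L α n
  | inf {n : ℕ} : BoundedFormula L α (n + 1) → BoundedFormula L α n
  | sup {n : ℕ} : BoundedFormula L α (n + 1) → BoundedFormula L α n

/-- Formulas with free variables from `α`. -/
abbrev Formula (L : MetricSignature.{u}) (α : Type v) : Type (max u v) := L.BoundedFormula α 0

/-- Sentences. -/
abbrev Sentence (L : MetricSignature.{u}) : Type u := L.Formula Empty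

section Semantics

variable {L : MetricSignature.{u}} {M : Type v} [MetricSpace M] [L.Structure M] {α : Type w}

/-- The interpretation of a term. -/
def Term.eval (v : α → M) : L.Term α → M
  | .var i => v i
  | .func f ts => Structure.funMap f fun i => (ts i).eval v

/-- The interpretation of a formula, with values in `[0,1]`. -/
def BoundedFormula.eval (v : α → M) : ∀ {n : ℕ}, L.BoundedFormula α n → (Fin n → M) → unitInterval
  | _, .dist s t, a =>
      ⟨Dist.dist (s.eval (Sum.elim v a)) (t.eval (Sum.elim v a)),
        dist_nonneg, Structure.dist_le_one L _ _⟩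
  | _, .pred P ts, a => Structure.predMap P fun i => (ts i).eval (Sum.elim v a)
  | _, .conn c φs, a => c fun i => (φs i).eval v a
  | _, .inf φ, a => ⨅ b : M, φ.eval v (Fin.snoc a b)
  | _, .sup φ, a => ⨆ b : M, φ.eval v (Fin.snoc a b)

/-- The value `φ(v)` of a formula at a tuple `v`. -/
def Formula.value (φ : L.Formula α) (v : α → M) : unitInterval := BoundedFormula.eval v φ Fin.elim0

end Semantics

/-- A set of sentences; the sentence `φ` stands for the condition `φ = 0`. -/
abbrev Theory (L : MetricSignature.{u}) : Type u := Set L.Sentence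

/-- `M` satisfies all the conditions in `T`. -/
def Theory.Models {L : MetricSignature.{u}} (T : L.Theory) (M : Type v) [MetricSpace M]
    [L.Structure M] : Prop :=
  ∀ φ ∈ T, Formula.value φ (Empty.elim : Empty → M) = 0

/-- The theory has a model. -/
def Theory.IsConsistent {L : MetricSignature.{u}} (T : L.Theory) : Prop :=
  ∃ (M : Type u) (_ : MetricSpace M) (_ : L.Structure M), T.Models M

/-- The set of logical consequences of a theory. -/
def Theory.consequences {L : MetricSignature.{u}} (T : L.Theory) : L.Theory :=
  {φ | ∀ (M : Type u) [MetricSpace M] [L.Structure M], T.Models M →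
    Formula.value φ (Empty.elim : Empty → M) = 0}

/-- A consistent theory is complete if its set of logical consequences is maximal among the sets
of logical consequences of consistent theories. -/
def Theory.IsComplete {L : MetricSignature.{u}} (T : L.Theory) : Prop :=
  Maximal (fun S : L.Theory => ∃ T' : L.Theory, T'.IsConsistent ∧ S = T'.consequences)
    T.consequences ∧ T.IsConsistent

/-! ### Types and monster models -/

section Types

variable (L : MetricSignature.{u}) (M : Type v) [MetricSpace M] [L.Structure M]

/-- The complete type of a tuple over the empty set, recorded as the family of the values of all
formulas. -/
def tp {L : MetricSignature.{u}} {M : Type v} [MetricSpace M] [L.Structure M] {α : Type w}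
    (a : α → M) : L.Formula α → unitInterval :=
  fun φ => Formula.value φ a

/-- The space `S_n(∅)` of complete `n`-types of the theory of `M`. A family of values is such a
type if and only if it is finitely approximately satisfied in `M`, that is, if it lies in the
closure of the set of types realized in `M`, for the topology of pointwise convergence. If `M` is
a monster model then all these types are realized in `M`. -/
def TypeSpace (n : ℕ) : Set (L.Formula (Fin n) → unitInterval) :=
  closure (Set.range fun a : Fin n → M => tp a)

/-- A CL-formula in `n` variables over the empty set: a continuous real-valued function on
`S_n(∅)`. -/
abbrev CLFormula (n : ℕ) : Type _ := C(L.TypeSpace M n, ℝ)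

/-- The value of a CL-formula at a tuple is its value at the type of the tuple. -/
def CLFormula.value {L : MetricSignature.{u}} {M : Type v} [MetricSpace M] [L.Structure M] {n : ℕ}
    (φ : L.CLFormula M n) (a : Fin n → M) : ℝ :=
  φ ⟨tp a, subset_closure ⟨a, rfl⟩⟩

/-- `κ`-saturation: every type in finitely many variables over a set `A` of fewer than `κ`
parameters is realized. A type is given by a set of conditions `φ = 0`, where the variables of `φ`
are the `n` variables of the type and names for the elements of `A`; it is consistent with the
theory of `M` with names for the elements of `A` if and only if its finite parts are approximately
satisfied in `M`. -/
def IsSaturated (κ : Cardinal.{v}) : Prop :=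
  ∀ A : Set M, Cardinal.mk A < κ → ∀ (n : ℕ) (Γ : Set (L.Formula (Fin n ⊕ A))),
    (∀ Γ₀ : Set (L.Formula (Fin n ⊕ A)), Γ₀ ⊆ Γ → Γ₀.Finite → ∀ ε : ℝ, 0 < ε →
      ∃ a : Fin n → M, ∀ φ ∈ Γ₀, (Formula.value φ (Sum.elim a ((↑) : A → M)) : ℝ) ≤ ε) →
    ∃ a : Fin n → M, ∀ φ ∈ Γ, Formula.value φ (Sum.elim a ((↑) : A → M)) = 0

/-- Automorphisms of a continuous structure. -/
structure IsAutomorphism (σ : M ≃ M) : Prop where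
  map_dist : ∀ a b : M, dist (σ a) (σ b) = dist a b
  map_fun : ∀ {n : ℕ} (f : L.Functions n) (a : Fin n → M),
    σ (Structure.funMap f a) = Structure.funMap f (σ ∘ a)
  map_pred : ∀ {n : ℕ} (P : L.Predicates n) (a : Fin n → M),
    Structure.predMap P (σ ∘ a) = Structure.predMap P a

/-- Strong `κ`-homogeneity: every elementary map between subsets of `M` of cardinality less than
`κ` extends to an automorphism of `M`. -/
def IsStronglyHomogeneous (κ : Cardinal.{v}) : Prop :=
  ∀ A : Set M, Cardinal.mk A < κ → ∀ f : A → M,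
    (∀ φ : L.Formula A, Formula.value φ f = Formula.value φ ((↑) : A → M)) →
    ∃ σ : M ≃ M, L.IsAutomorphism M σ ∧ ∀ a : A, σ a = f a

end Types

/-- `M` is a monster model of `T` with degree of saturation `κ`. -/
structure Theory.IsMonster {L : MetricSignature.{u}} (T : L.Theory) (κ : Cardinal.{u})
    (M : Type u) [MetricSpace M] [L.Structure M] : Prop where
  models : T.Models M
  isStrongLimit : κ.IsStrongLimit
  card_lt : L.card < κ
  saturated : L.IsSaturated M κ
  homogeneous : L.IsStronglyHomogeneous M κ

end MetricSignature

/-! ### First-order index structures -/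

section Index

variable (L' : FirstOrder.Language.{u, v})

/-- The tuples `i` and `j` have the same quantifier-free type. -/
def SameQFType {I : Type w} {J : Type x} [L'.Structure I] [L'.Structure J] {n : ℕ}
    (i : Fin n → I) (j : Fin n → J) : Prop :=
  ∀ φ : L'.Formula (Fin n), φ.IsQF → (φ.Realize i ↔ φ.Realize j)

/-- A structure is locally finite if every finite subset generates a finite substructure. -/
def IsLocallyFinite (I : Type w) [L'.Structure I] : Prop :=
  ∀ S : Set I, S.Finite → (FirstOrder.Language.Substructure.closure L' S : Set I).Finite

/-- `C → (B)^A_r`: for every colouring of the embeddings of `A` into `C` with `r` colours there is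
an embedding `f` of `B` into `C` such that all the embeddings `f ∘ g`, where `g` is an embedding of
`A` into `B`, have the same colour. -/
def Arrow (A B C : Type w) [L'.Structure A] [L'.Structure B] [L'.Structure C] (r : ℕ) : Prop :=
  ∀ χ : (A ↪[L'] C) → Fin r, ∃ f : B ↪[L'] C, ∀ g g' : A ↪[L'] B, χ (f.comp g) = χ (f.comp g')

/-- The embedding Ramsey property of a class of structures; inclusions are read up to
isomorphism. -/
def EmbeddingRamseyProperty (K : Set (Bundled.{w} L'.Structure)) : Prop :=
  ∀ A ∈ K, ∀ B ∈ K, Nonempty (A ↪[L'] B) → ∀ r : ℕ,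
    ∃ C ∈ K, Nonempty (B ↪[L'] C) ∧ Arrow L' A B C r

end Index

/-! ### Generalized indiscernibles and the continuous modelling property -/

section Modelling

variable (L' : FirstOrder.Language.{u, v}) (L : MetricSignature.{x})

/-- The sequence `(a i : i ∈ I)` is `I`-indexed indiscernible (over the empty set). -/
def IsIndiscernible {I : Type w} [L'.Structure I] {M : Type y} [MetricSpace M] [L.Structure M]
    (a : I → M) : Prop :=
  ∀ (n : ℕ) (i j : Fin n → I), SameQFType L' i j →
    MetricSignature.tp (L := L) (a ∘ i) = MetricSignature.tp (L := L) (a ∘ j)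

/-- The sequence `(b j : j ∈ J)` is locally based on the sequence `(a i : i ∈ I)`. -/
def IsLocallyBasedOn {I J : Type w} [L'.Structure I] [L'.Structure J] {M : Type y} [MetricSpace M]
    [L.Structure M] (b : J → M) (a : I → M) : Prop :=
  ∀ (n : ℕ) (Δ : Set (L.CLFormula M n)), Δ.Finite → ∀ (j : Fin n → J) (ε : ℝ), 0 < ε →
    ∃ i : Fin n → I, SameQFType L' i j ∧
      ∀ φ ∈ Δ, |MetricSignature.CLFormula.value φ (b ∘ j) -
        MetricSignature.CLFormula.value φ (a ∘ i)| ≤ ε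

/-- `I`-indexed indiscernibles have the continuous modelling property in `T`: in every monster
model `M` of `T` for which `I` is small, there is for every `I`-indexed sequence in `M` an
`I`-indiscernible sequence in `M` that is locally based on it. -/
def HasCMPIn (I : Type w) [L'.Structure I] (L : MetricSignature.{max w x}) (T : L.Theory) : Prop :=
  ∀ (κ : Cardinal.{max w x}) (M : Type (max w x)) [MetricSpace M] [L.Structure M],
    T.IsMonster κ M → Cardinal.lift.{x} (Cardinal.mk I) < κ →
      ∀ a : I → M, ∃ b : I → M, IsIndiscernible L' L b ∧ IsLocallyBasedOn L' L b a

/-- `I`-indexed indiscernibles have the continuous modelling property: they have it in every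
complete continuous theory. -/
def HasCMP (I : Type w) [L'.Structure I] : Prop :=
  ∀ (L : MetricSignature.{max w x}) (T : L.Theory), T.IsComplete → HasCMPIn.{u, v, w, x} L' I L T

end Modelling

end ContinuousModelTheory

end

/-! From Ramsey to modelling: fix a finite part F of the index structure, finitely many formulas and
a precision. Every formula, applied to a tuple from F, colours the copies in `I` of the substructure
generated by that tuple, by the small subinterval of [0,1] containing the value of the formula. The
Ramsey property, applied once per colouring (`EmbeddingRamseyProperty.exists_embedding_forall`),
yields a copy of the substructure generated by F on which the given sequence is nearly
indiscernible. An ultrafilter limit of these pullbacks is a type in variables indexed by `I`.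
Saturation realizes it (`IsType.exists_realization`), and a realization is indiscernible. It is
locally based on the given sequence because the copies preserve quantifier-free types and
CL-formulas are continuous on the type space.

From modelling to Ramsey: if the Ramsey property fails for A, B and r colours, compactness gives a
colouring of the copies of A in all of `I` without a monochromatic copy of B
(`exists_bad_colouring`). Enumerating A turns it into a colouring of m-tuples of `I`. Place `I` with
this colouring inside a monster model with discrete metric and one predicate per colour. For an
indiscernible sequence all copies of A inside a copy of B look alike; being locally based transfers
this to some copy of B in the original sequence, which is then monochromatic, a contradiction.

The monster model is built by hand (`Generic`). Levels are indexed by a well-order in which small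
sets are bounded. Level β realizes every colouring of tuples from the earlier points together with a
set of fresh labels, so any partial isomorphism into the earlier levels extends
(`Generic.exists_extend`). Labels named by earlier points serve the back-and-forth; labels from X
serve external structures and finite tuples. Homogeneity follows by back-and-forth and Zorn, and
saturation by realizing in one level the atomic diagram of a tuple in an ultrapower; homogeneity
then does the work of quantifier elimination. -/

namespace ContinuousModelTheory

namespace MetricSignature

/-! ### Renaming and binding variables, supports of formulas -/

section Renaming

variable {L : MetricSignature.{u}} {α : Type v} {β : Type w}

/-- Rename the variables of a term. -/
def Term.relabel (f : α → β) : L.Term α → L.Term β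
  | .var i => .var (f i)
  | .func g ts => .func g fun i => (ts i).relabel f

/-- Rename the free variables of a formula. -/
def BoundedFormula.relabel (f : α → β) : ∀ {n : ℕ}, L.BoundedFormula α n → L.BoundedFormula β n
  | _, .dist s t => .dist (s.relabel (Sum.map f id)) (t.relabel (Sum.map f id))
  | _, .pred P ts => .pred P fun i => (ts i).relabel (Sum.map f id)
  | _, .conn c φs => .conn c fun i => (φs i).relabel f
  | _, .inf φ => .inf (φ.relabel f)
  | _, .sup φ => .sup (φ.relabel f)

/-- The renaming of variables that turns the free variable `i` into a new quantifiable variable. -/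
def bindVar [DecidableEq α] (i : α) (n : ℕ) : α ⊕ Fin n → α ⊕ Fin (n + 1) :=
  Sum.elim (fun j => if j = i then Sum.inr 0 else Sum.inl j) fun k => Sum.inr k.succ

/-- Turn the free variable `i` into a new quantifiable variable. -/
def BoundedFormula.bind [DecidableEq α] (i : α) :
    ∀ {n : ℕ}, L.BoundedFormula α n → L.BoundedFormula α (n + 1)
  | n, .dist s t => .dist (s.relabel (bindVar i n)) (t.relabel (bindVar i n))
  | n, .pred P ts => .pred P fun k => (ts k).relabel (bindVar i n)
  | _, .conn c φs => .conn c fun k => (φs k).bind i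
  | _, .inf φ => .inf (φ.bind i)
  | _, .sup φ => .sup (φ.bind i)

/-- The connective measuring the distance from a fixed tuple of truth values. -/
def distConn {k : ℕ} (r : Fin k → unitInterval) : C(Fin k → unitInterval, unitInterval) where
  toFun v := ⟨dist v r, dist_nonneg, (dist_pi_le_iff zero_le_one).2 fun i =>
    Real.dist_le_of_mem_Icc_01 (v i).2 (r i).2⟩
  continuous_toFun := by fun_prop

/-- The formula measuring the distance of the values of finitely many formulas from `r`. -/
def Formula.distFrom {k : ℕ} (φ : Fin k → L.Formula α) (r : Fin k → unitInterval) : L.Formula α :=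
  .conn (distConn r) φ

/-- The infimum of a formula over the values of the free variable `i`. -/
def Formula.infVar [DecidableEq α] (i : α) (φ : L.Formula α) : L.Formula α :=
  .inf (BoundedFormula.bind i φ)

end Renaming

/-! ### Values of renamed and bound formulas, finite supports, invariance under automorphisms. -/

section Eval

variable {L : MetricSignature.{u}} {M : Type y} [MetricSpace M] [L.Structure M]
  {α : Type v} {β : Type w}

theorem Term.eval_relabel (f : α → β) (c : β → M) (t : L.Term α) :
    (t.relabel f).eval c = t.eval (c ∘ f) := by
  induction t with
  | var i => rfl
  | func g ts ih => simp only [Term.relabel, Term.eval, ih]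

theorem BoundedFormula.eval_relabel (f : α → β) (c : β → M) {n : ℕ} (φ : L.BoundedFormula α n)
    (a : Fin n → M) : (φ.relabel f).eval c a = φ.eval (c ∘ f) a := by
  have key (n : ℕ) (a : Fin n → M) : Sum.elim c a ∘ Sum.map f id = Sum.elim (c ∘ f) a := by
    ext (_ | _) <;> rfl
  induction φ with
  | dist s t => simp only [relabel, eval, Term.eval_relabel, key]
  | pred P ts => simp only [relabel, eval, Term.eval_relabel, key]
  | conn u φs ih => simp only [relabel, eval, ih]
  | inf φ ih => simp only [relabel, eval, ih]
  | sup φ ih => simp only [relabel, eval, ih]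

theorem Formula.value_relabel (f : α → β) (c : β → M) (φ : L.Formula α) :
    Formula.value (BoundedFormula.relabel f φ) c = Formula.value φ (c ∘ f) :=
  BoundedFormula.eval_relabel f c φ _

/-- Quantifiers bind the last variable, so the new one is inserted in first place: `Fin.cons` and
`Fin.snoc` commute, which lets the induction pass under quantifiers. -/
theorem BoundedFormula.eval_bind [DecidableEq α] (i : α) (c : α → M) (b : M) {n : ℕ}
    (φ : L.BoundedFormula α n) (a : Fin n → M) :
    (φ.bind i).eval c (Fin.cons b a : Fin (n + 1) → M) = φ.eval (Function.update c i b) a := by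
  have key (n : ℕ) (a : Fin n → M) : Sum.elim c (Fin.cons b a : Fin (n + 1) → M) ∘ bindVar i n =
      Sum.elim (Function.update c i b) a := by
    ext (j | k)
    · by_cases h : j = i <;> simp [bindVar, h]
    · simp [bindVar]
  induction φ with
  | dist s t => simp only [bind, eval, Term.eval_relabel, key]
  | pred P ts => simp only [bind, eval, Term.eval_relabel, key]
  | conn u φs ih => simp only [bind, eval, ih]
  | inf φ ih => simp only [bind, eval, ← Fin.cons_snoc_eq_snoc_cons, ih]
  | sup φ ih => simp only [bind, eval, ← Fin.cons_snoc_eq_snoc_cons, ih]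

theorem Formula.value_infVar [DecidableEq α] (i : α) (φ : L.Formula α) (c : α → M) :
    (Formula.infVar i φ).value c = ⨅ b : M, φ.value (Function.update c i b) := by
  have h (b : M) : (Fin.snoc Fin.elim0 b : Fin 1 → M) = Fin.cons b Fin.elim0 := by
    ext k; fin_cases k; rfl
  simp only [Formula.infVar, Formula.value, BoundedFormula.eval, h, BoundedFormula.eval_bind]

theorem Formula.value_distFrom_le_iff {k : ℕ} (φ : Fin k → L.Formula α) (r : Fin k → unitInterval)
    (c : α → M) {ε : ℝ} (hε : 0 ≤ ε) :
    ((Formula.distFrom φ r).value c : ℝ) ≤ ε ↔ ∀ l, dist ((φ l).value c) (r l) ≤ ε :=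
  dist_pi_le_iff hε

theorem Term.exists_finset_support (t : L.Term α) :
    ∃ s : Finset α, ∀ c c' : α → M, (∀ i ∈ s, c i = c' i) → t.eval c = t.eval c' := by
  classical
  induction t with
  | var i => exact ⟨{i}, fun c c' h => h i (by simp)⟩
  | func f ts ih =>
    choose s hs using ih
    refine ⟨Finset.univ.biUnion s, fun c c' h => ?_⟩
    have : ∀ k, (ts k).eval c = (ts k).eval c' := fun k =>
      hs k c c' fun i hi => h i (Finset.mem_biUnion.2 ⟨k, Finset.mem_univ k, hi⟩)
    simp only [Term.eval, this]

theorem Term.exists_finset_support_sum {n : ℕ} (t : L.Term (α ⊕ Fin n)) :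
    ∃ s : Finset α, ∀ c c' : α → M, (∀ i ∈ s, c i = c' i) → ∀ a : Fin n → M,
      t.eval (Sum.elim c a) = t.eval (Sum.elim c' a) := by
  classical
  obtain ⟨s, hs⟩ := t.exists_finset_support (M := M)
  refine ⟨s.toLeft, fun c c' h a => hs _ _ ?_⟩
  rintro (i | k) hi
  · exact h i (by simpa using hi)
  · rfl

variable (M) in
-- Support is meant semantically, in terms of values in `M`. It reduces statements about infinitely
-- many variables to finitely many, both when types of infinite tuples are realized and in the proof
-- of saturation.
theorem BoundedFormula.exists_finset_support {n : ℕ} (φ : L.BoundedFormula α n) :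
    ∃ s : Finset α, ∀ c c' : α → M, (∀ i ∈ s, c i = c' i) → ∀ a, φ.eval c a = φ.eval c' a := by
  classical
  induction φ with
  | dist s t =>
    obtain ⟨s₁, h₁⟩ := s.exists_finset_support_sum (M := M)
    obtain ⟨s₂, h₂⟩ := t.exists_finset_support_sum (M := M)
    refine ⟨s₁ ∪ s₂, fun c c' h a => ?_⟩
    simp only [eval, h₁ c c' (fun i hi => h i (Finset.mem_union_left _ hi)),
      h₂ c c' (fun i hi => h i (Finset.mem_union_right _ hi))]
  | pred P ts =>
    choose s hs using fun k => (ts k).exists_finset_support_sum (M := M)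
    refine ⟨Finset.univ.biUnion s, fun c c' h a => ?_⟩
    have : ∀ k, (ts k).eval (Sum.elim c a) = (ts k).eval (Sum.elim c' a) := fun k =>
      hs k c c' (fun i hi => h i (Finset.mem_biUnion.2 ⟨k, Finset.mem_univ k, hi⟩)) a
    simp only [eval, this]
  | conn u φs ih =>
    choose s hs using ih
    refine ⟨Finset.univ.biUnion s, fun c c' h a => ?_⟩
    have : ∀ k, (φs k).eval c a = (φs k).eval c' a := fun k =>
      hs k c c' (fun i hi => h i (Finset.mem_biUnion.2 ⟨k, Finset.mem_univ k, hi⟩)) a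
    simp only [eval, this]
  | inf φ ih =>
    obtain ⟨s, hs⟩ := ih
    exact ⟨s, fun c c' h a => by simp only [eval, hs c c' h]⟩
  | sup φ ih =>
    obtain ⟨s, hs⟩ := ih
    exact ⟨s, fun c c' h a => by simp only [eval, hs c c' h]⟩

theorem Term.eval_automorphism {σ : M ≃ M} (hσ : L.IsAutomorphism M σ) (c : α → M)
    (t : L.Term α) : t.eval (σ ∘ c) = σ (t.eval c) := by
  induction t with
  | var i => rfl
  | func f ts ih =>
    simp only [Term.eval, ih, hσ.map_fun]
    rfl

theorem BoundedFormula.eval_automorphism {σ : M ≃ M} (hσ : L.IsAutomorphism M σ) (c : α → M)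
    {n : ℕ} (φ : L.BoundedFormula α n) (a : Fin n → M) : φ.eval (σ ∘ c) (σ ∘ a) = φ.eval c a := by
  induction φ with
  | dist s t =>
    simp only [eval, ← Sum.comp_elim, Term.eval_automorphism hσ, hσ.map_dist]
  | pred P ts =>
    simp only [eval, ← Sum.comp_elim, Term.eval_automorphism hσ]
    exact hσ.map_pred P _
  | conn u φs ih => simp only [eval, ih]
  | inf φ ih =>
    simp only [eval, ← ih, Fin.comp_snoc]
    exact (σ.iInf_congr fun _ => rfl).symm
  | sup φ ih =>
    simp only [eval, ← ih, Fin.comp_snoc]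
    exact (σ.iSup_congr fun _ => rfl).symm

theorem Formula.value_automorphism {σ : M ≃ M} (hσ : L.IsAutomorphism M σ) (c : α → M)
    (φ : L.Formula α) : φ.value (σ ∘ c) = φ.value c := by
  have h : σ ∘ (Fin.elim0 : Fin 0 → M) = Fin.elim0 := funext fun k => k.elim0
  rw [Formula.value, ← h]
  exact BoundedFormula.eval_automorphism hσ c φ _

end Eval

/-! ### Realizing types of infinite tuples -/

section Realize

variable {L : MetricSignature.{u}} {M : Type v} [MetricSpace M] [L.Structure M] {α : Type w}

variable (M) in
/-- The value of `φ` at a tuple from `M` depends only on the entries indexed by `S`. -/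
def Formula.SupportedOn (φ : L.Formula α) (S : Set α) : Prop :=
  ∀ c c' : α → M, (∀ i ∈ S, c i = c' i) → φ.value c = φ.value c'

/-- Interpolate with the tuple that is `c` on `S` and `c'` off `S`: it agrees with `c` on `S` and
with `c'` on `S'`. -/
theorem Formula.SupportedOn.inter {φ : L.Formula α} {S S' : Set α} (h : φ.SupportedOn M S)
    (h' : φ.SupportedOn M S') : φ.SupportedOn M (S ∩ S') := by
  classical
  intro c c' hc
  refine (h c (fun i => if i ∈ S then c i else c' i) fun i hi => by simp [hi]).trans
    (h' _ _ fun i hi => ?_)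
  by_cases hS : i ∈ S
  · simpa [hS] using hc i ⟨hS, hi⟩
  · simp [hS]

variable (M) in
/-- `p` is a complete type in the variables `α` of the theory of `M`: it is finitely approximately
satisfied in `M`. -/
def IsType (p : L.Formula α → unitInterval) : Prop :=
  ∀ (Φ : Set (L.Formula α)), Φ.Finite → ∀ ε : ℝ, 0 < ε →
    ∃ c : α → M, ∀ φ ∈ Φ, dist (φ.value c) (p φ) ≤ ε

theorem IsType.eq_value_of_const {p : L.Formula α → unitInterval} (hp : IsType M p)
    {φ : L.Formula α} (h : φ.SupportedOn M ∅) (c : α → M) : φ.value c = p φ := by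
  refine eq_of_forall_dist_le fun ε hε => ?_
  obtain ⟨d, hd⟩ := hp {φ} (Set.toFinite _) ε hε
  rw [h c d (by simp)]
  exact hd φ rfl

/-- Extend a realization of the restriction of a type to an initial segment of the variables by one
more variable. -/
theorem IsType.exists_extend [LinearOrder α] {κ : Cardinal.{v}} (hM : L.IsSaturated M κ)
    {p : L.Formula α → unitInterval} (hp : IsType M p) (i : α) (b : α → M)
    (hcard : Cardinal.mk (b '' Set.Iio i) < κ)
    (hb : ∀ φ : L.Formula α, φ.SupportedOn M (Set.Iio i) → φ.value b = p φ) :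
    ∃ z : M, ∀ φ : L.Formula α, φ.SupportedOn M (Set.Iic i) →
      φ.value (Function.update b i z) = p φ := by
  set A : Set M := b '' Set.Iio i with hA
  -- Variables below `i` become names for parameters; all others become the single unknown. Those
  -- above `i` are harmless, since only formulas supported on `Set.Iic i` are used.
  let ρ : α → Fin 1 ⊕ A := fun j =>
    if h : j < i then Sum.inr ⟨b j, j, h, rfl⟩ else Sum.inl 0
  have hρ (a : Fin 1 → M) (φ : L.Formula α) (hφ : φ.SupportedOn M (Set.Iic i)) :
      φ.value (Sum.elim a ((↑) : A → M) ∘ ρ) = φ.value (Function.update b i (a 0)) := by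
    refine hφ _ _ fun j hj => ?_
    rcases lt_or_eq_of_le (Set.mem_Iic.1 hj) with h | rfl
    · simp [ρ, h, h.ne]
    · simp [ρ]
  let ψ : L.Formula α → L.Formula α := fun φ => Formula.distFrom (fun _ : Fin 1 => φ) fun _ => p φ
  have hψ (φ : L.Formula α) (c : α → M) {ε : ℝ} (hε : 0 ≤ ε) :
      ((ψ φ).value c : ℝ) ≤ ε ↔ dist (φ.value c) (p φ) ≤ ε := by
    simpa using Formula.value_distFrom_le_iff (fun _ : Fin 1 => φ) (fun _ => p φ) c hε
  have hψs (φ : L.Formula α) (hφ : φ.SupportedOn M (Set.Iic i)) :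
      (ψ φ).SupportedOn M (Set.Iic i) := by
    intro c c' h
    apply Subtype.ext
    change dist (fun _ : Fin 1 => φ.value c) _ = dist (fun _ : Fin 1 => φ.value c') _
    rw [hφ c c' h]
  have hΓ : ∀ Γ₀ ⊆ (fun φ => BoundedFormula.relabel ρ (ψ φ)) '' {φ | φ.SupportedOn M (Set.Iic i)},
      Γ₀.Finite → ∀ ε : ℝ, 0 < ε → ∃ a : Fin 1 → M, ∀ φ ∈ Γ₀,
        (Formula.value φ (Sum.elim a ((↑) : A → M)) : ℝ) ≤ ε := by
    intro Γ₀ hΓ₀ hfin ε hε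
    obtain ⟨Φ, hΦ, hΦfin, rfl⟩ := Set.exists_subset_image_finite_and.1 ⟨Γ₀, hΓ₀, hfin, rfl⟩
    obtain ⟨k, f, -, rfl⟩ := hΦfin.fin_param
    -- `θ` says that some value of the variable `i` brings all the chosen formulas close to the
    -- values prescribed by `p`. It mentions only earlier variables and `p θ = 0`, so it vanishes at
    -- `b`, which is approximate satisfiability over the parameters.
    set θ : L.Formula α := Formula.infVar i (Formula.distFrom f (p ∘ f)) with hθ
    have hθs : θ.SupportedOn M (Set.Iio i) := by
      intro c c' h
      rw [hθ, Formula.value_infVar, Formula.value_infVar]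
      congr 1
      funext z
      apply Subtype.ext
      change dist (fun l => (f l).value _) _ = dist (fun l => (f l).value _) _
      congr 1
      funext l
      refine hΦ ⟨l, rfl⟩ _ _ fun j hj => ?_
      rcases lt_or_eq_of_le (Set.mem_Iic.1 hj) with h' | rfl
      · simp [h'.ne, h j h']
      · simp
    have hθ0 : p θ = 0 := by
      refine eq_of_forall_dist_le fun δ hδ => ?_
      obtain ⟨c, hc⟩ := hp (insert θ (Set.range f)) (hΦfin.insert θ) (δ / 2) (half_pos hδ)
      have h₁ : (θ.value c : ℝ) ≤ δ / 2 := by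
        refine le_trans (?_ : _ ≤ ((Formula.distFrom f (p ∘ f)).value c : ℝ))
          ((Formula.value_distFrom_le_iff _ _ c (half_pos hδ).le).2 fun l => hc _ (by simp))
        rw [hθ, Formula.value_infVar]
        refine Subtype.coe_le_coe.2 ((iInf_le _ (c i)).trans ?_)
        rw [Function.update_eq_self]
      have h₂ := hc θ (by simp)
      have h₃ : dist (θ.value c) 0 ≤ δ / 2 := by
        rw [Subtype.dist_eq, Real.dist_eq, Set.Icc.coe_zero, sub_zero,
          abs_of_nonneg (θ.value c).2.1]
        exact h₁
      linarith [dist_triangle_left (p θ) 0 (θ.value c)]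
    have hlt : ⨅ z : M, (Formula.distFrom f (p ∘ f)).value (Function.update b i z) <
        (⟨min ε 1, Set.mem_Icc.2 ⟨(lt_min hε one_pos).le, min_le_right _ _⟩⟩ : unitInterval) := by
      rw [← Formula.value_infVar, hb θ hθs, hθ0]
      exact Subtype.coe_lt_coe.1 (lt_min hε one_pos)
    obtain ⟨z, hz⟩ := iInf_lt_iff.1 hlt
    refine ⟨fun _ => z, ?_⟩
    rintro _ ⟨φ, ⟨l, rfl⟩, rfl⟩
    rw [Formula.value_relabel, hρ _ _ (hψs _ (hΦ ⟨l, rfl⟩)), hψ _ _ hε.le]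
    exact (Formula.value_distFrom_le_iff f (p ∘ f) _ hε.le).1
      ((Subtype.coe_lt_coe.2 hz).le.trans (min_le_left _ _)) l
  obtain ⟨a, ha⟩ := hM A hcard 1 _ hΓ
  refine ⟨a 0, fun φ hφ => ?_⟩
  have h := ha _ ⟨φ, hφ, rfl⟩
  rw [Formula.value_relabel, hρ a _ (hψs φ hφ)] at h
  exact dist_le_zero.1 ((hψ φ _ le_rfl).1 (by simp [h]))

/-- In a saturated structure, every type in a small number of variables is realized. -/
theorem IsType.exists_realization {κ : Cardinal.{v}} (hM : L.IsSaturated M κ)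
    {p : L.Formula α → unitInterval} (hp : IsType M p)
    (hcard : Cardinal.lift.{v} (Cardinal.mk α) < Cardinal.lift.{w} κ) :
    ∃ b : α → M, ∀ φ : L.Formula α, φ.value b = p φ := by
  classical
  have : Nonempty M := Structure.nonempty L
  let _ : LinearOrder α := linearOrderOfSTO WellOrderingRel
  have : WellFoundedLT α := ⟨WellOrderingRel.isWellOrder.wf⟩
  have hsmall (i : α) (b : α → M) : Cardinal.mk (b '' Set.Iio i) < κ := by
    rw [← Cardinal.lift_lt.{v, w}]
    refine lt_of_le_of_lt ?_ hcard
    refine (Cardinal.mk_image_le_lift (f := b) (s := Set.Iio i)).trans ?_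
    exact Cardinal.lift_le.2 (Cardinal.mk_set_le _)
  let good (i : α) (b : α → M) : Prop :=
    ∀ φ : L.Formula α, φ.SupportedOn M (Set.Iic i) → φ.value b = p φ
  -- The recursion picks a good value if there is one; that there always is one is shown afterwards
  -- by induction.
  let F (i : α) (b : ∀ j, j < i → M) : M :=
    Classical.epsilon fun z => good i fun j => if h : j < i then b j h else z
  let b : α → M := wellFounded_lt.fix F
  have hb (i : α) : b i = Classical.epsilon fun z =>
      good i fun j => if j < i then b j else z := by
    have h := wellFounded_lt.fix_eq F i
    exact h
  -- Only finitely many variables from `S` matter to `φ`, so goodness at the largest of them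
  -- suffices; if there are none, `φ` is constant.
  have hsegment (S : Set α) (hS : ∀ i ∈ S, good i b ∧ Set.Iic i ⊆ S) (φ : L.Formula α)
      (hφ : φ.SupportedOn M S) : φ.value b = p φ := by
    obtain ⟨s, hs⟩ := BoundedFormula.exists_finset_support M φ
    have h' : φ.SupportedOn M (S ∩ s) := hφ.inter fun c c' h => hs c c' h _
    by_cases hne : (s.filter (· ∈ S)).Nonempty
    · set m := (s.filter (· ∈ S)).max' hne
      have hm := (Finset.mem_filter.1 ((s.filter (· ∈ S)).max'_mem hne)).2
      refine (hS m hm).1 φ fun c c' h => h' c c' fun i hi => h i ?_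
      exact Finset.le_max' _ _ (Finset.mem_filter.2 ⟨hi.2, hi.1⟩)
    · refine hp.eq_value_of_const (fun c c' h => h' c c' fun i hi => ?_) b
      exact absurd ⟨i, Finset.mem_filter.2 ⟨hi.2, hi.1⟩⟩ hne
  have hgood (i : α) : good i b := by
    induction i using WellFoundedLT.induction with
    | ind i ih =>
      obtain ⟨z, hz⟩ := hp.exists_extend hM i b (hsmall i b)
        (hsegment (Set.Iio i) fun j hj =>
          ⟨ih j hj, fun k hk => Set.mem_Iio.2 (lt_of_le_of_lt hk hj)⟩)
      have hagree (z : M) (φ : L.Formula α) (hφ : φ.SupportedOn M (Set.Iic i)) :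
          φ.value (fun j => if j < i then b j else z) = φ.value (Function.update b i z) := by
        refine hφ _ _ fun j hj => ?_
        rcases lt_or_eq_of_le (Set.mem_Iic.1 hj) with h | rfl
        · simp [h, h.ne]
        · simp
      have hspec := Classical.epsilon_spec
        (p := fun z => good i fun j => if j < i then b j else z)
        ⟨z, fun φ hφ => (hagree z φ hφ).trans (hz φ hφ)⟩
      rw [← hb i] at hspec
      intro φ hφ
      have h := (hagree (b i) φ hφ).symm.trans (hspec φ hφ)
      rwa [Function.update_eq_self] at h
  exact ⟨b, fun φ => hsegment Set.univ (fun i _ => ⟨hgood i, Set.subset_univ _⟩) φ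
    fun c c' h => congrArg φ.value (funext fun i => h i trivial)⟩

end Realize

end MetricSignature

end ContinuousModelTheory

namespace ContinuousModelTheory

open FirstOrder FirstOrder.Language MetricSignature

/-! ### Quantifier-free types and embeddings -/

section QFType

variable {L' : FirstOrder.Language.{u, v}} {I : Type w} {J : Type x} {K : Type y}
  [L'.Structure I] [L'.Structure J] [L'.Structure K] {n : ℕ}

theorem SameQFType.symm {i : Fin n → I} {j : Fin n → J} (h : SameQFType L' i j) :
    SameQFType L' j i :=
  fun φ hφ => (h φ hφ).symm

theorem SameQFType.trans {i : Fin n → I} {j : Fin n → J} {k : Fin n → K}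
    (h : SameQFType L' i j) (h' : SameQFType L' j k) : SameQFType L' i k :=
  fun φ hφ => (h φ hφ).trans (h' φ hφ)

theorem sameQFType_embedding_comp (f : I ↪[L'] J) (i : Fin n → I) : SameQFType L' (f ∘ i) i := by
  intro φ hφ
  have h := hφ.realize_embedding f (v := i) (xs := default)
  rwa [Subsingleton.elim (f ∘ default) (default : Fin 0 → J)] at h

/-- Tuples with the same quantifier-free type generate isomorphic substructures. -/
theorem SameQFType.exists_embedding {i : Fin n → I} {j : Fin n → J} (h : SameQFType L' i j) :
    ∃ g : Substructure.closure L' (Set.range i) ↪[L'] J,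
      ∀ k, g ⟨i k, Substructure.subset_closure ⟨k, rfl⟩⟩ = j k := by
  have hterm (z : Substructure.closure L' (Set.range i)) :
      ∃ t : L'.Term (Fin n), t.realize i = z := by
    obtain ⟨t, ht⟩ := Substructure.mem_closure_iff_exists_term.1 z.2
    refine ⟨t.relabel fun s => s.2.choose, ?_⟩
    rw [Term.realize_relabel, ← ht]
    congr 1
    funext s
    exact s.2.choose_spec
  have heq (t₁ t₂ : L'.Term (Fin n)) :
      t₁.realize i = t₂.realize i ↔ t₁.realize j = t₂.realize j := by
    have := h (t₁.equal t₂) (BoundedFormula.IsAtomic.equal _ _).isQF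
    simpa only [Formula.realize_equal] using this
  have hrel {m : ℕ} (R : L'.Relations m) (ts : Fin m → L'.Term (Fin n)) :
      Structure.RelMap R (fun k => (ts k).realize i) ↔
        Structure.RelMap R fun k => (ts k).realize j := by
    have := h (R.formula ts) (BoundedFormula.IsAtomic.rel _ _).isQF
    simpa only [Formula.realize_rel] using this
  -- Each element of the closure is named by a term. Equalities and relations between terms are
  -- atomic, so evaluating the same terms at `j` is injective and preserves the structure, whichever
  -- terms are chosen.
  choose T hT using hterm
  refine ⟨{ toFun := fun z => (T z).realize j, inj' := ?_, map_fun' := ?_, map_rel' := ?_ }, ?_⟩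
  · intro z z' hz
    exact Subtype.ext ((hT z).symm.trans (((heq _ _).2 hz).trans (hT z')))
  · intro m f zs
    refine (heq _ (Term.func f fun k => T (zs k))).1 ?_
    rw [hT, Term.realize_func]
    simp only [hT]
    rfl
  · intro m R zs
    refine (hrel R fun k => T (zs k)).symm.trans ?_
    simp only [hT]
    rfl
  · intro k
    exact (heq _ (Term.var k)).1 (hT _)

end QFType

/-! ### The embedding Ramsey property for several colourings -/

section Ramsey

variable {L' : FirstOrder.Language.{u, v}} {I : Type w} [L'.Structure I]

/-- The colourings are treated one at a time. Take C arrowing B for the new colouring, embed C in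
`I` homogeneously for the old ones by induction, and choose B inside C for the new one. Quantifying
over all B after fixing the colourings makes this passage to C possible. -/
theorem EmbeddingRamseyProperty.exists_embedding_forall
    (hR : EmbeddingRamseyProperty L' (L'.age I)) {K : Type y} (s : Finset K)
    (A : K → Bundled.{w} L'.Structure) (hA : ∀ k, A k ∈ L'.age I) (r : K → ℕ)
    (χ : ∀ k, (A k ↪[L'] I) → Fin (r k)) :
    ∀ B ∈ L'.age I, ∃ f : B ↪[L'] I, ∀ k ∈ s, ∀ g g' : A k ↪[L'] B,
      χ k (f.comp g) = χ k (f.comp g') := by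
  classical
  induction s using Finset.induction_on with
  | empty =>
    intro B hB
    obtain ⟨f⟩ := hB.2
    exact ⟨f, by simp⟩
  | insert k s hk ih =>
    intro B hB
    by_cases hne : Nonempty (A k ↪[L'] B)
    · obtain ⟨C, hC, -, hCB⟩ := hR (A k) (hA k) B hB hne (r k)
      obtain ⟨F, hF⟩ := ih C hC
      obtain ⟨f, hf⟩ := hCB fun h => χ k (F.comp h)
      refine ⟨F.comp f, fun l hl g g' => ?_⟩
      rcases Finset.mem_insert.1 hl with rfl | hl
      · simpa only [Embedding.comp_assoc] using hf g g'
      · simpa only [Embedding.comp_assoc] using hF l hl (f.comp g) (f.comp g')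
    · obtain ⟨f, hf⟩ := ih B hB
      refine ⟨f, fun l hl g g' => ?_⟩
      rcases Finset.mem_insert.1 hl with rfl | hl
      · exact absurd ⟨g⟩ hne
      · exact hf l hl g g'

/-- The cell of a truth value in the partition of `[0,1]` into intervals of length `1 / N`. -/
noncomputable def cell (N : ℕ) (z : unitInterval) : Fin (N + 1) :=
  ⟨⌊(N : ℝ) * z⌋₊, Nat.lt_succ_of_le <| Nat.floor_le_of_le <|
    mul_le_of_le_one_right (Nat.cast_nonneg N) z.2.2⟩

theorem dist_le_of_cell_eq {N : ℕ} (hN : 0 < N) {z t : unitInterval}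
    (h : cell N z = cell N t) : dist z t ≤ 1 / N := by
  have hN' : (0 : ℝ) < N := Nat.cast_pos.2 hN
  have hfl : ⌊(N : ℝ) * z⌋₊ = ⌊(N : ℝ) * t⌋₊ := congrArg Fin.val h
  have h₁ := Nat.floor_le (mul_nonneg hN'.le z.2.1)
  have h₂ := Nat.lt_floor_add_one ((N : ℝ) * z)
  have h₃ := Nat.floor_le (mul_nonneg hN'.le t.2.1)
  have h₄ := Nat.lt_floor_add_one ((N : ℝ) * t)
  rw [hfl] at h₁ h₂
  rw [Subtype.dist_eq, Real.dist_eq, le_div_iff₀ hN']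
  calc |(z : ℝ) - t| * N = |((z : ℝ) - t) * N| := by rw [abs_mul, abs_of_pos hN']
    _ ≤ 1 := abs_le.2 (by constructor <;> linarith)

/-- Under the embedding Ramsey property, every sequence contains copies of a given finite part of
the index structure that are approximately indiscernible. -/
theorem EmbeddingRamseyProperty.exists_approx_indiscernible
    (hR : EmbeddingRamseyProperty L' (L'.age I)) {L : MetricSignature.{x}} {M : Type y}
    [MetricSpace M] [L.Structure M] (a : I → M) (F : Finset I)
    (Φ : Finset (Σ n, L.Formula (Fin n))) {N : ℕ} (hN : 0 < N) :
    ∃ f : I → I, (∀ (n : ℕ) (i : Fin n → I), (∀ k, i k ∈ F) → SameQFType L' (f ∘ i) i) ∧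
      ∀ (n : ℕ) (φ : L.Formula (Fin n)), ⟨n, φ⟩ ∈ Φ → ∀ i j : Fin n → I, (∀ k, i k ∈ F) →
        (∀ k, j k ∈ F) → SameQFType L' i j →
          dist (φ.value (a ∘ f ∘ i)) (φ.value (a ∘ f ∘ j)) ≤ 1 / N := by
  classical
  let B := Substructure.closure L' (F : Set I)
  have hFB {z : I} (hz : z ∈ F) : z ∈ B := Substructure.subset_closure hz
  have hB : (⟨B, inferInstance⟩ : Bundled L'.Structure) ∈ L'.age I :=
    age.fg_substructure (Substructure.fg_closure F.finite_toSet)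
  let K := Σ φ : Φ, (Fin φ.1.1 → F)
  let A (k : K) : L'.Substructure I := Substructure.closure L' (Set.range fun l => (k.2 l : I))
  let A' (k : K) : Bundled.{w} L'.Structure := ⟨A k, inferInstance⟩
  have hA (k : K) : A' k ∈ L'.age I :=
    age.fg_substructure (Substructure.fg_closure (Set.finite_range _))
  have hgen (k : K) (l : Fin k.1.1.1) : (k.2 l : I) ∈ A k :=
    Substructure.subset_closure ⟨l, rfl⟩
  -- An embedding is coloured by the cell of the formula's value at the image of the generating
  -- tuple. There are `N + 1` cells because the value 1 has its own.
  let χ (k : K) (h : A' k ↪[L'] I) : Fin (N + 1) :=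
    cell N (k.1.1.2.value fun l => a (h ⟨k.2 l, hgen k l⟩))
  obtain ⟨f, hf⟩ := hR.exists_embedding_forall Finset.univ A' hA (fun _ => N + 1) χ _ hB
  let f' : I → I := fun z => if hz : z ∈ B then f ⟨z, hz⟩ else z
  have hf' {z : I} (hz : z ∈ B) : f' z = f ⟨z, hz⟩ := dif_pos hz
  refine ⟨f', fun n i hi => ?_, fun n φ hφ i j hi hj hij => dist_le_of_cell_eq hN ?_⟩
  · have h : f' ∘ i = f ∘ fun k => ⟨i k, hFB (hi k)⟩ := funext fun k => hf' (hFB (hi k))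
    rw [h]
    exact (sameQFType_embedding_comp f _).trans
      (sameQFType_embedding_comp B.subtype fun k => ⟨i k, hFB (hi k)⟩).symm
  · let k : K := ⟨⟨⟨n, φ⟩, hφ⟩, fun l => ⟨i l, hi l⟩⟩
    have hAB : A k ≤ B := Substructure.closure_mono (Set.range_subset_iff.2 fun l => hi l)
    let j' : Fin n → B := fun l => ⟨j l, hFB (hj l)⟩
    -- The tuples `i` and `j` are the images of the same generators under two embeddings of `A k`
    -- into `B`: the inclusion and `g`. Monochromaticity compares exactly these.
    obtain ⟨g, hg⟩ := (hij.trans (sameQFType_embedding_comp B.subtype j')).exists_embedding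
    have h := hf k (Finset.mem_univ k) (Substructure.inclusion hAB) g
    have h₁ : f' ∘ i = fun l => f.comp (Substructure.inclusion hAB) ⟨i l, hgen k l⟩ :=
      funext fun l => hf' (hFB (hi l))
    have h₂ : f' ∘ j = fun l => f.comp g ⟨i l, hgen k l⟩ := funext fun l =>
      (hf' (hFB (hj l))).trans (congrArg f (hg l).symm)
    rw [h₁, h₂]
    exact h

end Ramsey

/-! ### The embedding Ramsey property implies the continuous modelling property -/

section Modelling

open Filter Topology

/-- The index set `D` collects finite parts, finite sets of formulas and precisions; along an
ultrafilter finer than `atTop` the errors of the approximately indiscernible pullbacks tend to 0. -/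
theorem EmbeddingRamseyProperty.exists_indiscernible {L' : FirstOrder.Language.{u, v}}
    {I : Type w} [L'.Structure I] (hR : EmbeddingRamseyProperty L' (L'.age I))
    {L : MetricSignature.{x}} {M : Type y} [MetricSpace M] [L.Structure M] {κ : Cardinal.{y}}
    (hM : L.IsSaturated M κ)
    (hcard : Cardinal.lift.{y} (Cardinal.mk I) < Cardinal.lift.{w} κ) (a : I → M) :
    ∃ b : I → M, IsIndiscernible L' L b ∧ IsLocallyBasedOn L' L b a := by
  classical
  let D : Type _ := Finset I × Finset (Σ n, L.Formula (Fin n)) × ℕ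
  let U : Ultrafilter D := Ultrafilter.of atTop
  have hU : (U : Filter D) ≤ atTop := Ultrafilter.of_le _
  choose f hfqf hfφ using fun d : D =>
    hR.exists_approx_indiscernible a d.1 d.2.1 (Nat.succ_pos d.2.2)
  have hF {n : ℕ} (i : Fin n → I) : ∀ᶠ d in (U : Filter D), ∀ k, i k ∈ d.1 := by
    filter_upwards [hU (mem_atTop ((Finset.univ.image i, ∅, 0) : D))] with d hd k
    exact hd.1 (Finset.mem_image_of_mem i (Finset.mem_univ k))
  have hlim (φ : L.Formula I) :
      ∃ z : unitInterval, Tendsto (fun d => φ.value (a ∘ f d)) U (𝓝 z) := by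
    obtain ⟨z, -, hz⟩ := isCompact_univ.ultrafilter_le_nhds
      (U.map fun d => φ.value (a ∘ f d)) (by simp)
    exact ⟨z, hz⟩
  choose p hp using hlim
  have hptype : IsType M p := by
    intro Φ hΦ ε hε
    have h : ∀ᶠ d in (U : Filter D), ∀ φ ∈ Φ, dist (φ.value (a ∘ f d)) (p φ) ≤ ε :=
      (eventually_all_finite hΦ).2 fun φ _ =>
        ((tendsto_iff_dist_tendsto_zero.1 (hp φ)).eventually (Iic_mem_nhds hε))
    obtain ⟨d, hd⟩ := h.exists
    exact ⟨a ∘ f d, hd⟩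
  obtain ⟨b, hb⟩ := hptype.exists_realization hM hcard
  have hbp {n : ℕ} (φ : L.Formula (Fin n)) (i : Fin n → I) :
      Tendsto (fun d => φ.value (a ∘ f d ∘ i)) U (𝓝 (φ.value (b ∘ i))) := by
    have h := hp (BoundedFormula.relabel i φ)
    rw [← hb, Formula.value_relabel] at h
    simpa only [Formula.value_relabel, Function.comp_assoc] using h
  refine ⟨b, fun n i j hij => funext fun φ => ?_, fun n Δ hΔ j ε hε => ?_⟩
  · refine eq_of_forall_dist_le fun ε hε => ?_
    obtain ⟨N, hN⟩ := exists_nat_one_div_lt hε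
    have hd : ∀ᶠ d in (U : Filter D), (⟨n, φ⟩ : Σ n, L.Formula (Fin n)) ∈ d.2.1 ∧ N ≤ d.2.2 := by
      filter_upwards [hU (mem_atTop ((∅, {⟨n, φ⟩}, N) : D))] with d hd
      exact ⟨hd.2.1 (Finset.mem_singleton_self _), hd.2.2⟩
    refine le_of_tendsto ((hbp φ i).dist (hbp φ j)) ?_
    filter_upwards [hF i, hF j, hd] with d hi hj hd
    refine (hfφ d n φ hd.1 i j hi hj hij).trans (le_trans ?_ hN.le)
    push_cast
    exact one_div_le_one_div_of_le (by positivity) (by simpa using hd.2)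
  · have htp : Tendsto (fun d => (⟨tp (a ∘ f d ∘ j), subset_closure ⟨_, rfl⟩⟩ : L.TypeSpace M n)) U
        (𝓝 ⟨tp (b ∘ j), subset_closure ⟨_, rfl⟩⟩) :=
      tendsto_subtype_rng.2 (tendsto_pi_nhds.2 fun φ => hbp φ j)
    have hΔ' : ∀ᶠ d in (U : Filter D), ∀ φ ∈ Δ,
        |CLFormula.value φ (b ∘ j) - CLFormula.value φ (a ∘ f d ∘ j)| ≤ ε :=
      (eventually_all_finite hΔ).2 fun φ _ => by
        have h := (φ.continuous.tendsto _).comp htp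
        have h' := (tendsto_iff_dist_tendsto_zero.1 h).eventually (Iic_mem_nhds hε)
        filter_upwards [h'] with d hd
        rw [abs_sub_comm]
        exact hd
    obtain ⟨d, hd, hdF⟩ := (hΔ'.and (hF j)).exists
    exact ⟨f d ∘ j, hfqf d n j hdF, hd⟩

theorem EmbeddingRamseyProperty.hasCMP {L' : FirstOrder.Language.{u, v}} {I : Type w}
    [L'.Structure I] (hR : EmbeddingRamseyProperty L' (L'.age I)) :
    HasCMP.{u, v, w, x} L' I := by
  intro L T _ κ M _ _ hM hcard a
  refine hR.exists_indiscernible hM.saturated ?_ a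
  have h := Cardinal.lift_lt.{max w x, w}.2 hcard
  simpa using h

end Modelling

end ContinuousModelTheory

namespace ContinuousModelTheory

/-! ### A homogeneous structure with a generic colouring of `m`-tuples -/

/-- A relation that is a partial isomorphism between two sets with coloured `m`-tuples. -/
structure IsPartialIso {Z : Type u} {Z' : Type v} {V : Type w} {m : ℕ} (P : (Fin m → Z) → V)
    (P' : (Fin m → Z') → V) (R : Set (Z × Z')) : Prop where
  eq_iff : ∀ a ∈ R, ∀ b ∈ R, a.1 = b.1 ↔ a.2 = b.2
  map_eq : ∀ t : Fin m → Z × Z', (∀ k, t k ∈ R) →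
    P (fun k => (t k).1) = P' fun k => (t k).2

section PartialIso

variable {Z : Type u} {Z' : Type v} {V : Type w} {m : ℕ} {P : (Fin m → Z) → V}
  {P' : (Fin m → Z') → V} {R : Set (Z × Z')}

theorem IsPartialIso.swap (h : IsPartialIso P P' R) :
    IsPartialIso P' P (Prod.swap ⁻¹' R) where
  eq_iff _ ha _ hb := (h.eq_iff _ ha _ hb).symm
  map_eq t ht := (h.map_eq (fun k => (t k).swap) ht).symm

/-- Each condition concerns finitely many pairs, which lie in a single member of the directed
family. -/
theorem IsPartialIso.sUnion {c : Set (Set (Z × Z'))} (hc : DirectedOn (· ⊆ ·) c)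
    (hne : c.Nonempty) (h : ∀ R ∈ c, IsPartialIso P P' R) : IsPartialIso P P' (⋃₀ c) := by
  have key (s : Set (Z × Z')) (hs : s.Finite) (hsc : s ⊆ ⋃₀ c) : ∃ R ∈ c, s ⊆ R :=
    DirectedOn.exists_mem_subset_of_finite_of_subset_sUnion hne hc hs hsc
  refine ⟨fun a ha b hb => ?_, fun t ht => ?_⟩
  · obtain ⟨R, hR, hab⟩ := key {a, b} (Set.toFinite _) (by
      rintro z (rfl | rfl) <;> assumption)
    exact (h R hR).eq_iff a (hab (by simp)) b (hab (by simp))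
  · obtain ⟨R, hR, htR⟩ := key (Set.range t) (Set.finite_range t) (by
      rintro _ ⟨k, rfl⟩
      exact ht k)
    exact (h R hR).map_eq t fun k => htR ⟨k, rfl⟩

end PartialIso

section Generic

variable (Θ : Type u) [LinearOrder Θ] [WellFoundedLT Θ] (X : Type u) (m : ℕ) (V : Type)

/-- The points of level `β`, in terms of the points of smaller levels: a point consists of a
colouring of the `m`-tuples from the points of smaller level and a set of new points, and of one of
these new points. -/
def LevelStep (β : Θ) (N : ∀ γ, γ < β → Type u) : Type u :=
  ((Fin m → (Σ γ : {γ // γ < β}, N γ.1 γ.2) ⊕ ((Σ γ : {γ // γ < β}, N γ.1 γ.2) ⊕ X)) → V) ×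
    ((Σ γ : {γ // γ < β}, N γ.1 γ.2) ⊕ X)

/-- The points of level `β`. -/
def Level : Θ → Type u :=
  wellFounded_lt.fix (LevelStep Θ X m V)

theorem level_eq (β : Θ) : Level Θ X m V β = LevelStep Θ X m V β fun γ _ => Level Θ X m V γ :=
  wellFounded_lt.fix_eq (LevelStep Θ X m V) β

/-- The union of all levels. -/
def Generic : Type u := Σ β, Level Θ X m V β

namespace Generic

variable {Θ X m V}

/-- The level of a point. -/
def level (z : Generic Θ X m V) : Θ := z.1

variable (X m V) in
/-- The points of level less than `β`. -/
abbrev Below (β : Θ) : Type u := {z : Generic Θ X m V // z.level < β}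

variable (X m V) in
/-- Labels for the new points of level `β` that belong to the same colouring. -/
abbrev Label (β : Θ) : Type u := Below X m V β ⊕ X

variable (X m V) in
/-- The colourings that give rise to new points of level `β`. -/
abbrev Pattern (β : Θ) : Type u := (Fin m → Below X m V β ⊕ Label X m V β) → V

theorem exists_injective_pattern (β : Θ) :
    ∃ f : Pattern X m V β × Label X m V β → Level Θ X m V β, Function.Injective f := by
  let e : Below X m V β ≃ Σ γ : {γ // γ < β}, Level Θ X m V γ :=
    { toFun := fun z => ⟨⟨z.1.1, z.2⟩, z.1.2⟩
      invFun := fun z => ⟨⟨z.1.1, z.2⟩, z.1.2⟩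
      left_inv := fun _ => rfl
      right_inv := fun _ => rfl }
  let e' := e.sumCongr (Equiv.refl X)
  let E :=
    (((Equiv.refl (Fin m)).arrowCongr (e.sumCongr e')).arrowCongr (Equiv.refl V)).prodCongr e'
  exact ⟨_, (E.trans (Equiv.cast (level_eq Θ X m V β).symm)).injective⟩

/-- The new point of level `β` with a given colouring and label. -/
noncomputable def point (β : Θ) (Q : Pattern X m V β) (e : Label X m V β) : Generic Θ X m V :=
  ⟨β, (exists_injective_pattern β).choose (Q, e)⟩

theorem point_inj {β : Θ} {Q Q' : Pattern X m V β} {e e' : Label X m V β}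
    (h : point β Q e = point β Q' e') : Q = Q' ∧ e = e' := by
  have h' := (exists_injective_pattern β).choose_spec (eq_of_heq (Sigma.mk.inj h).2)
  exact Prod.mk.inj h'

/-- The old points, and the new points that belong to `Q`. -/
noncomputable def decode (β : Θ) (Q : Pattern X m V β) :
    Below X m V β ⊕ Label X m V β → Generic Θ X m V :=
  Sum.elim (↑) (point β Q)

theorem level_decode_le {β : Θ} (Q : Pattern X m V β) (s : Below X m V β ⊕ Label X m V β) :
    (decode β Q s).level ≤ β := by
  rcases s with z | e
  · exact z.2.le
  · exact le_rfl

theorem decode_injective {β : Θ} (Q : Pattern X m V β) : Function.Injective (decode β Q) := by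
  rintro (z | e) (z' | e') h
  · exact congrArg Sum.inl (Subtype.ext h)
  · exact absurd (congrArg level h) z.2.ne
  · exact absurd (congrArg level h).symm z'.2.ne
  · exact congrArg Sum.inr (point_inj h).2

open Classical in
/-- The colour of an `m`-tuple. A tuple that contains new points belonging to `Q` and old points
has the colour prescribed by `Q`. -/
noncomputable def colour [Nonempty V] (t : Fin m → Generic Θ X m V) : V :=
  if h : ∃ (s : Σ β, Pattern X m V β × (Fin m → Below X m V β ⊕ Label X m V β)),
    (∃ k, (s.2.2 k).isRight) ∧ t = decode s.1 s.2.1 ∘ s.2.2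
  then h.choose.2.1 h.choose.2.2 else Classical.arbitrary V

/-- The choice in `colour` is unambiguous: a new point forces `β` to be the highest level in the
tuple, it remembers its pattern, and `decode` is injective. -/
theorem colour_decode [Nonempty V] {β : Θ} (Q : Pattern X m V β)
    (t : Fin m → Below X m V β ⊕ Label X m V β) (ht : ∃ k, (t k).isRight) :
    colour (decode β Q ∘ t) = Q t := by
  have h : ∃ (s : Σ β, Pattern X m V β × (Fin m → Below X m V β ⊕ Label X m V β)),
    (∃ k, (s.2.2 k).isRight) ∧ decode β Q ∘ t = decode s.1 s.2.1 ∘ s.2.2 := ⟨⟨β, Q, t⟩, ht, rfl⟩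
  rw [colour, dif_pos h]
  obtain ⟨⟨k', hk'⟩, heq⟩ := h.choose_spec
  generalize h.choose = s at hk' heq ⊢
  obtain ⟨β', Q', t'⟩ := s
  dsimp only at hk' heq ⊢
  obtain ⟨k, hk⟩ := ht
  obtain ⟨e, he⟩ := Sum.isRight_iff.1 hk
  obtain ⟨e', he'⟩ := Sum.isRight_iff.1 hk'
  have h₁ : β' ≤ β := by
    have h := congrFun heq k'
    have h' := level_decode_le Q (t k')
    simp only [Function.comp_apply] at h
    rw [h, he'] at h'
    exact h'
  have h₂ : β ≤ β' := by
    have h := congrFun heq k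
    have h' := level_decode_le Q' (t' k)
    simp only [Function.comp_apply] at h
    rw [← h, he] at h'
    exact h'
  obtain rfl := le_antisymm h₁ h₂
  have hQ : Q' = Q := by
    have h := congrFun heq k'
    simp only [Function.comp_apply, he'] at h
    rcases hz : t k' with z | e₁
    · rw [hz] at h
      exact absurd (congrArg level h) z.2.ne
    · rw [hz] at h
      exact (point_inj h).1.symm
  subst hQ
  rw [(decode_injective Q').comp_left heq]

/-- Partial isomorphisms into the points of level less than `β` can be extended by values of
level `β`. -/
theorem exists_extend [Nonempty V] {Z : Type v} {P : (Fin m → Z) → V} {β : Θ}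
    {R : Set (Z × Generic Θ X m V)} (hR : IsPartialIso P colour R)
    (hβ : ∀ a ∈ R, a.2.level < β) (E : Set Z) (e : E → Label X m V β)
    (he : Function.Injective e) :
    ∃ R' : Set (Z × Generic Θ X m V), R ⊆ R' ∧ IsPartialIso P colour R' ∧
      (∀ z ∈ E, ∃ y, (z, y) ∈ R') ∧ ∀ a ∈ R', (a ∈ R ∨ a.1 ∈ E) ∧ a.2.level ≤ β := by
  classical
  -- The code of `z` is its old value if `R` provides one, and otherwise its label. The pattern `Q`
  -- below copies `P` along this correspondence.
  let corr : Below X m V β ⊕ Label X m V β → Z → Prop := fun s z =>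
    Sum.elim (fun y : Below X m V β => (z, y.1) ∈ R)
      (fun l => (∀ y, (z, y) ∉ R) ∧ ∃ hz : z ∈ E, e ⟨z, hz⟩ = l) s
  have corr_left {s z z'} (h : corr s z) (h' : corr s z') : z = z' := by
    rcases s with y | l
    · exact (hR.eq_iff _ h _ h').2 rfl
    · obtain ⟨-, hz, rfl⟩ := h
      obtain ⟨-, hz', h'⟩ := h'
      exact (congrArg Subtype.val (he h')).symm
  have corr_right {s s' z} (h : corr s z) (h' : corr s' z) : s = s' := by
    rcases s with y | l <;> rcases s' with y' | l'
    · exact congrArg Sum.inl (Subtype.ext ((hR.eq_iff _ h _ h').1 rfl))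
    · exact absurd h (h'.1 _)
    · exact absurd h' (h.1 _)
    · obtain ⟨-, hz, rfl⟩ := h
      obtain ⟨-, hz', rfl⟩ := h'
      rfl
  let Q : Pattern X m V β := fun s =>
    if h : ∃ t : Fin m → Z, ∀ k, corr (s k) (t k) then P h.choose else Classical.arbitrary V
  have hQ {s : Fin m → Below X m V β ⊕ Label X m V β} {t : Fin m → Z}
      (h : ∀ k, corr (s k) (t k)) : Q s = P t := by
    have h' : ∃ t : Fin m → Z, ∀ k, corr (s k) (t k) := ⟨t, h⟩
    simp only [Q, dif_pos h']
    exact congrArg P (funext fun k => corr_left (h'.choose_spec k) (h k))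
  refine ⟨{a | ∃ s, corr s a.1 ∧ a.2 = decode β Q s}, fun a ha => ?_, ⟨?_, ?_⟩, fun z hz => ?_, ?_⟩
  · exact ⟨Sum.inl ⟨a.2, hβ a ha⟩, ha, rfl⟩
  · rintro ⟨z, _⟩ ⟨s, hs, rfl⟩ ⟨z', _⟩ ⟨s', hs', rfl⟩
    simp only at hs hs' ⊢
    refine ⟨?_, fun h => ?_⟩
    · rintro rfl
      rw [corr_right hs hs']
    · obtain rfl := decode_injective Q h
      exact corr_left hs hs'
  · intro t ht
    choose s hs hs' using ht
    have h₂ : (fun k => (t k).2) = decode β Q ∘ s := funext hs'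
    -- `Q` governs only tuples with a new point; all other tuples lie in `R`, where the colours
    -- already agree.
    by_cases hr : ∃ k, (s k).isRight
    · rw [h₂, colour_decode Q s hr, hQ hs]
    · refine hR.map_eq t fun k => ?_
      have hk := hs k
      have hk' := hs' k
      rcases hsk : s k with y | l
      · rw [hsk] at hk hk'
        rw [← Prod.mk.eta (p := t k), hk']
        exact hk
      · exact absurd ⟨k, by rw [hsk]; rfl⟩ hr
  · by_cases h : ∃ y, (z, y) ∈ R
    · obtain ⟨y, hy⟩ := h
      exact ⟨y, Sum.inl ⟨y, hβ _ hy⟩, hy, rfl⟩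
    · exact ⟨_, Sum.inr (e ⟨z, hz⟩), ⟨not_exists.1 h, hz, rfl⟩, rfl⟩
  · rintro ⟨z, _⟩ ⟨s, hs, rfl⟩
    refine ⟨?_, level_decode_le Q s⟩
    rcases s with y | l
    · exact Or.inl hs
    · exact Or.inr hs.2.choose

/-! ### Homogeneity -/

/-- Both coordinates of every pair in `R` have level in `W`. -/
def Within (R : Set (Generic Θ X m V × Generic Θ X m V)) (W : Set Θ) : Prop :=
  ∀ a ∈ R, a.1.level ∈ W ∧ a.2.level ∈ W

/-- All points with level in `W` occur as first and as second coordinates of pairs in `R`. -/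
def Covers (R : Set (Generic Θ X m V × Generic Θ X m V)) (W : Set Θ) : Prop :=
  ∀ z : Generic Θ X m V, z.level ∈ W → (∃ y, (z, y) ∈ R) ∧ ∃ y, (y, z) ∈ R

/-- Every point below `β` serves as its own label, so level `β` has room for the images of all of
them at once. -/
theorem exists_extend_forth [Nonempty V] [NoMaxOrder Θ] {β : Θ}
    {R : Set (Generic Θ X m V × Generic Θ X m V)} (hR : IsPartialIso colour colour R)
    (hβ : Within R (Set.Iio β)) :
    ∃ β' R', β < β' ∧ R ⊆ R' ∧ IsPartialIso colour colour R' ∧ Within R' (Set.Iio β') ∧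
      ∀ z : Generic Θ X m V, z.level < β → ∃ y, (z, y) ∈ R' := by
  obtain ⟨R', h₁, h₂, h₃, h₄⟩ := exists_extend hR (fun a ha => (hβ a ha).2) {z | z.level < β}
    (fun z => Sum.inl z) Sum.inl_injective
  obtain ⟨β', hβ'⟩ := exists_gt β
  refine ⟨β', R', hβ', h₁, h₂, fun a ha => ⟨?_, (h₄ a ha).2.trans_lt hβ'⟩, h₃⟩
  rcases (h₄ a ha).1 with h | h
  · exact lt_trans (hβ a h).1 hβ'
  · exact lt_trans h hβ'

theorem exists_extend_back_and_forth [Nonempty V] [NoMaxOrder Θ] {β : Θ}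
    {R : Set (Generic Θ X m V × Generic Θ X m V)} (hR : IsPartialIso colour colour R)
    (hβ : Within R (Set.Iio β)) :
    ∃ β' R', β < β' ∧ R ⊆ R' ∧ IsPartialIso colour colour R' ∧ Within R' (Set.Iio β') ∧
      Covers R' (Set.Iio β) := by
  obtain ⟨β₁, R₁, h₁, hRR₁, hR₁, hβ₁, hc₁⟩ := exists_extend_forth hR hβ
  obtain ⟨β₂, R₂, h₂, hRR₂, hR₂, hβ₂, hc₂⟩ :=
    exists_extend_forth hR₁.swap fun a ha => (hβ₁ _ ha).symm
  have hsub : R₁ ⊆ Prod.swap ⁻¹' R₂ := fun a ha => hRR₂ (by simpa using ha)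
  refine ⟨β₂, Prod.swap ⁻¹' R₂, h₁.trans h₂, hRR₁.trans hsub, hR₂.swap,
    fun a ha => (hβ₂ _ ha).symm, fun z hz => ⟨?_, ?_⟩⟩
  · obtain ⟨y, hy⟩ := hc₁ z hz
    exact ⟨y, hsub hy⟩
  · exact hc₂ z (lt_trans hz h₁)

/-- One round covers the levels below the old bound but uses points up to a larger one. After ω
rounds the two bounds coincide, and `W` is the union of the segments reached. -/
theorem exists_extend_segment [Nonempty V] [NoMaxOrder Θ] {β : Θ}
    {R : Set (Generic Θ X m V × Generic Θ X m V)} (hR : IsPartialIso colour colour R)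
    (hβ : Within R (Set.Iio β)) :
    ∃ W R', IsLowerSet W ∧ β ∈ W ∧ R ⊆ R' ∧ IsPartialIso colour colour R' ∧ Within R' W ∧
      Covers R' W := by
  let S := {s : Θ × Set (Generic Θ X m V × Generic Θ X m V) //
    IsPartialIso colour colour s.2 ∧ Within s.2 (Set.Iio s.1)}
  have hstep (s : S) : ∃ s' : S, s.1.1 < s'.1.1 ∧ s.1.2 ⊆ s'.1.2 ∧
      Covers s'.1.2 (Set.Iio s.1.1) := by
    obtain ⟨β', R', h₁, h₂, h₃, h₄, h₅⟩ := exists_extend_back_and_forth s.2.1 s.2.2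
    exact ⟨⟨(β', R'), h₃, h₄⟩, h₁, h₂, h₅⟩
  choose next hlt hsub hcov using hstep
  let s (n : ℕ) : S := next^[n] ⟨(β, R), hR, hβ⟩
  have hs (n : ℕ) : s (n + 1) = next (s n) := Function.iterate_succ_apply' _ _ _
  have hmono : Monotone fun n => (s n).1.2 := monotone_nat_of_le_succ fun n => by
    rw [hs]
    exact hsub _
  refine ⟨{γ | ∃ n, γ < (s n).1.1}, ⋃₀ Set.range fun n => (s n).1.2, ?_, ?_, ?_, ?_, ?_, ?_⟩
  · rintro γ γ' h ⟨n, hn⟩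
    exact ⟨n, h.trans_lt hn⟩
  · exact ⟨0 + 1, (hs 0).symm ▸ hlt (s 0)⟩
  · exact Set.subset_sUnion_of_mem ⟨0, rfl⟩
  · refine IsPartialIso.sUnion (directedOn_range.2 hmono.directed_le) (Set.range_nonempty _) ?_
    rintro _ ⟨n, rfl⟩
    exact (s n).2.1
  · rintro a ⟨_, ⟨n, rfl⟩, ha⟩
    exact ⟨⟨n, ((s n).2.2 a ha).1⟩, ⟨n, ((s n).2.2 a ha).2⟩⟩
  · rintro z ⟨n, hn⟩
    obtain ⟨⟨y, hy⟩, ⟨y', hy'⟩⟩ := hcov (s n) z hn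
    rw [← hs] at hy hy'
    exact ⟨⟨y, _, ⟨n + 1, rfl⟩, hy⟩, ⟨y', _, ⟨n + 1, rfl⟩, hy'⟩⟩

/-- Every partial isomorphism between sets of points of bounded level extends to an
automorphism. -/
theorem exists_automorphism [Nonempty V] [Nonempty X] [NoMaxOrder Θ] {β : Θ}
    {R : Set (Generic Θ X m V × Generic Θ X m V)} (hR : IsPartialIso colour colour R)
    (hβ : Within R (Set.Iio β)) :
    ∃ σ : Generic Θ X m V ≃ Generic Θ X m V, (∀ a ∈ R, σ a.1 = a.2) ∧
      ∀ t : Fin m → Generic Θ X m V, colour (σ ∘ t) = colour t := by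
  obtain ⟨W₀, R₀, hW₀, -, hRR₀, hR₀, hw₀, hc₀⟩ := exists_extend_segment hR hβ
  obtain ⟨S, hS, hmax⟩ := zorn_subset_nonempty
    {S : Set (Generic Θ X m V × Generic Θ X m V) |
      IsPartialIso colour colour S ∧ ∃ W, IsLowerSet W ∧ Within S W ∧ Covers S W}
    (by
      intro c hc hchain hne
      have h (S) (hS : S ∈ c) := (hc hS).2
      choose! W hW hw hcov using h
      refine ⟨⋃₀ c, ⟨IsPartialIso.sUnion hchain.directedOn hne fun S hS => (hc hS).1,
        ⋃ S ∈ c, W S, ?_, ?_, ?_⟩, fun S hS => Set.subset_sUnion_of_mem hS⟩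
      · exact isLowerSet_iUnion₂ hW
      · rintro a ⟨S, hS, ha⟩
        exact ⟨Set.mem_biUnion hS (hw S hS a ha).1, Set.mem_biUnion hS (hw S hS a ha).2⟩
      · intro z hz
        obtain ⟨S, hS, hz⟩ := Set.mem_iUnion₂.1 hz
        obtain ⟨⟨y, hy⟩, ⟨y', hy'⟩⟩ := hcov S hS z hz
        exact ⟨⟨y, S, hS, hy⟩, ⟨y', S, hS, hy'⟩⟩)
    R₀ ⟨hR₀, W₀, hW₀, hw₀, hc₀⟩
  obtain ⟨hSiso, W, hW, hw, hcov⟩ := hmax.prop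
  -- A missing `γ` bounds `W`, so the maximal relation could be extended to cover a segment
  -- containing `γ`, where there is at least one point.
  have huniv (γ : Θ) : γ ∈ W := by
    by_contra hγ
    have hsub : W ⊆ Set.Iio γ := fun δ hδ => not_le.1 fun h => hγ (hW h hδ)
    obtain ⟨W', S', hW', hγ', hSS', hS', hw', hcov'⟩ := exists_extend_segment hSiso
      (β := γ) fun a ha => ⟨hsub (hw a ha).1, hsub (hw a ha).2⟩
    obtain ⟨⟨y, hy⟩, -⟩ := hcov' (point γ (fun _ => Classical.arbitrary V)
      (Sum.inr (Classical.arbitrary X))) hγ'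
    exact hγ (hw _ (hmax.le_of_ge ⟨hS', W', hW', hw', hcov'⟩ hSS' hy)).1
  choose f hf using fun z => (hcov z (huniv _)).1
  choose g hg using fun z => (hcov z (huniv _)).2
  refine ⟨⟨f, g, fun z => ?_, fun z => ?_⟩, fun a ha => ?_, fun t => ?_⟩
  · exact (hSiso.eq_iff _ (hg _) _ (hf _)).2 rfl
  · exact (hSiso.eq_iff _ (hf _) _ (hg _)).1 rfl
  · exact (hSiso.eq_iff _ (hf _) _ (hS (hRR₀ ha))).1 rfl
  · exact (hSiso.map_eq (fun k => (t k, f (t k))) fun k => hf _).symm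

end Generic

end Generic

end ContinuousModelTheory

namespace ContinuousModelTheory

open MetricSignature Filter

/-! ### The generic coloured structure as a monster model -/

/-- The signature with one `m`-ary predicate symbol for every colour. -/
def colourSignature (m : ℕ) (V : Type) : MetricSignature.{u} where
  Functions _ := PEmpty
  Predicates k := ULift.{u} {_c : V // k = m}
  funModulus f := f.elim
  funModulus_pos f := f.elim
  predModulus _ _ _ := 1
  predModulus_pos _ _ _ _ := one_pos

theorem card_colourSignature (m : ℕ) (V : Type) [Finite V] :
    (colourSignature.{u} m V).card = Cardinal.aleph0 := by
  have h₁ : Cardinal.mk (Σ n, (colourSignature.{u} m V).Functions n) = 0 :=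
    Cardinal.mk_eq_zero_iff.2 ⟨fun s => s.2.elim⟩
  have h₂ : Cardinal.mk (Σ n, (colourSignature.{u} m V).Predicates n) ≤ Cardinal.aleph0 := by
    have : Countable (Σ n, (colourSignature.{u} m V).Predicates n) := by
      refine Function.Injective.countable (f := fun s => s.2.down.1) ?_
      rintro ⟨n, ⟨c, rfl⟩⟩ ⟨n', ⟨c', rfl⟩⟩ rfl
      rfl
    exact Cardinal.mk_le_aleph0
  rw [card, h₁, zero_add]
  exact Cardinal.add_eq_right le_rfl h₂

namespace Generic

variable {Θ : Type u} [LinearOrder Θ] [WellFoundedLT Θ] {X : Type u} {m : ℕ} {V : Type}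

open Classical in
noncomputable instance : MetricSpace (Generic Θ X m V) where
  dist z t := if z = t then 0 else 1
  dist_self z := if_pos rfl
  dist_comm z t := by simp only [eq_comm]
  dist_triangle z t s := by
    by_cases h₁ : z = t <;> by_cases h₂ : t = s <;> by_cases h₃ : z = s <;> simp_all
  eq_of_dist_eq_zero {z t} h := by
    by_contra hne
    simp [hne] at h

theorem eq_of_dist_lt_one {z t : Generic Θ X m V} (h : dist z t < 1) : z = t := by
  by_contra hne
  exact absurd h (by simp [dist, hne])

theorem dist_of_ne {z t : Generic Θ X m V} (h : z ≠ t) : dist z t = 1 := if_neg h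

open Classical in
noncomputable instance [Nonempty V] [Nonempty X] [Nonempty Θ] :
    (colourSignature.{u} m V).Structure (Generic Θ X m V) where
  nonempty := ⟨point (Classical.arbitrary Θ) (fun _ => Classical.arbitrary V)
    (Sum.inr (Classical.arbitrary X))⟩
  complete := Metric.complete_of_cauchySeq_tendsto fun s hs => by
    obtain ⟨N, hN⟩ := Metric.cauchySeq_iff'.1 hs 1 one_pos
    exact ⟨s N, tendsto_const_nhds.congr' (eventually_atTop.2 ⟨N, fun n hn =>
      (eq_of_dist_lt_one (hN n hn)).symm⟩)⟩
  dist_le_one z t := by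
    by_cases h : z = t
    · simp [h]
    · exact (dist_of_ne h).le
  funMap f := f.elim
  predMap c t := if colour (t ∘ Fin.cast c.down.2.symm) = c.down.1 then 1 else 0
  funMap_modulus f := f.elim
  predMap_modulus P i ε hε a z t h := by
    rw [eq_of_dist_lt_one h, dist_self]
    exact hε.le

/-- The atomic formula that says that a tuple of variables has the colour `c`. -/
def colourFormula {α : Type w} (c : V) (t : Fin m → α) : (colourSignature.{u} m V).Formula α :=
  .pred (⟨c, rfl⟩ : ULift {_c : V // m = m}) fun k => .var (Sum.inl (t k))

/-- The atomic formula measuring the distance of two variables. -/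
def distFormula {L : MetricSignature.{u}} {α : Type w} (i j : α) : L.Formula α :=
  .dist (.var (Sum.inl i)) (.var (Sum.inl j))

section Structure

variable [Nonempty V] [Nonempty X] [Nonempty Θ]

open Classical in
theorem value_colourFormula {α : Type w} (c : V) (t : Fin m → α) (a : α → Generic Θ X m V) :
    (colourFormula c t).value a = if colour (a ∘ t) = c then 1 else 0 := rfl

theorem colour_eq_of_value_eq {α : Type w} {t t' : Fin m → α} {a a' : α → Generic Θ X m V}
    (h : ∀ c : V, (colourFormula c t : (colourSignature.{u} m V).Formula α).value a =
      (colourFormula c t').value a') :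
    colour (a ∘ t) = colour (a' ∘ t') := by
  have h' := h (colour (a ∘ t))
  rw [value_colourFormula, value_colourFormula, if_pos rfl] at h'
  by_contra hne
  rw [if_neg (Ne.symm hne)] at h'
  exact one_ne_zero h'

theorem value_distFormula {α : Type w} (i j : α) (a : α → Generic Θ X m V) :
    ((distFormula i j : (colourSignature.{u} m V).Formula α).value a : ℝ) = dist (a i) (a j) :=
  rfl

theorem isAutomorphism {σ : Generic Θ X m V ≃ Generic Θ X m V}
    (hσ : ∀ t : Fin m → Generic Θ X m V, colour (σ ∘ t) = colour t) :
    (colourSignature.{u} m V).IsAutomorphism (Generic Θ X m V) σ where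
  map_dist z t := by
    by_cases h : z = t
    · simp [h]
    · rw [dist_of_ne h, dist_of_ne fun h' => h (σ.injective h')]
  map_fun f := f.elim
  map_pred c t := by
    have h := hσ (t ∘ Fin.cast c.down.2.symm)
    classical exact if_congr (Eq.congr_left h) rfl rfl

theorem isPartialIso_range {α : Type w} {a a' : α → Generic Θ X m V}
    (h : ∀ φ : (colourSignature.{u} m V).Formula α, φ.value a = φ.value a') :
    IsPartialIso colour colour (Set.range fun i => (a i, a' i)) where
  eq_iff := by
    rintro _ ⟨i, rfl⟩ _ ⟨j, rfl⟩
    rw [← dist_eq_zero, ← dist_eq_zero (x := a' i), ← value_distFormula i j a,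
      ← value_distFormula i j a', h]
  map_eq t ht := by
    choose k hk using ht
    obtain rfl : t = fun l => (a (k l), a' (k l)) := funext fun l => (hk l).symm
    exact colour_eq_of_value_eq (t := k) (t' := k) fun c => h _

theorem isStronglyHomogeneous [NoMaxOrder Θ] {κ : Cardinal.{u}} (hκ : Cardinal.aleph0 ≤ κ)
    (hΘ : ∀ S : Set Θ, Cardinal.mk S < κ → ∃ β, ∀ γ ∈ S, γ < β) :
    (colourSignature.{u} m V).IsStronglyHomogeneous (Generic Θ X m V) κ := by
  intro A hA f hf
  obtain ⟨β, hβ⟩ := hΘ (Set.range (fun a : A => a.1.level) ∪ Set.range fun a : A => (f a).level)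
    ((Cardinal.mk_union_le _ _).trans_lt (Cardinal.add_lt_of_lt hκ
      (Cardinal.mk_range_le.trans_lt hA) (Cardinal.mk_range_le.trans_lt hA)))
  obtain ⟨σ, hσ, hσ'⟩ := exists_automorphism (isPartialIso_range fun φ => (hf φ).symm)
    (β := β) (by
      rintro _ ⟨a, rfl⟩
      exact ⟨hβ _ (Or.inl ⟨a, rfl⟩), hβ _ (Or.inr ⟨a, rfl⟩)⟩)
  exact ⟨σ, isAutomorphism hσ', fun a => hσ _ ⟨a, rfl⟩⟩

end Structure

/-- The limit, along an ultrafilter, of the isomorphism type over `A` of a finite tuple is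
realized. -/
theorem exists_limit_tuple [Nonempty V] [Finite V] [Infinite X] {A : Set (Generic Θ X m V)}
    {β : Θ} (hA : ∀ z ∈ A, z.level < β) {n : ℕ} (U : Ultrafilter (Fin n → Generic Θ X m V)) :
    ∃ a' : Fin n → Generic Θ X m V, ∀ s : Finset (Fin n ⊕ A),
      ∀ᶠ a in (U : Filter (Fin n → Generic Θ X m V)), IsPartialIso colour colour
        ((fun k => (Sum.elim a (↑) k, Sum.elim a' (↑) k)) '' (s : Set (Fin n ⊕ A))) := by
  classical
  let Y := Fin n → Generic Θ X m V
  -- This is the ultrapower. Since `V` is finite, colours of tuples of germs have limits, which give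
  -- its colouring `P`. The constant germs of elements of `A` are sent back to those elements, and
  -- the coordinate germs are then added at level `β`.
  let Z := (U : Filter Y).Germ (Generic Θ X m V)
  have hconst (F : Y → V) : ∃ c, ∀ᶠ a in (U : Filter Y), F a = c :=
    Ultrafilter.eventually_exists_iff.1 (Eventually.of_forall fun a => ⟨F a, rfl⟩)
  choose lim hlim using hconst
  let P : (Fin m → Z) → V := fun t => lim fun a => colour fun k => (t k).out a
  have hP (t : Fin m → Y → Generic Θ X m V) :
      ∀ᶠ a in (U : Filter Y), colour (fun k => t k a) = P fun k => (t k : Z) := by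
    have h₁ : ∀ᶠ a in (U : Filter Y), ∀ k, (Quotient.out (t k : Z)) a = t k a :=
      eventually_all.2 fun k => Germ.coe_eq.1 (Quotient.out_eq _)
    filter_upwards [h₁, hlim fun a => colour fun k => (Quotient.out (t k : Z)) a] with a ha ha'
    exact (congrArg colour (funext fun k => (ha k).symm)).trans ha'
  have hconst_inj {z z' : Generic Θ X m V} : ((fun _ => z : Y → _) : Z) = ((fun _ => z') : Y → _) ↔
      z = z' := by
    rw [Germ.coe_eq]
    exact eventually_const
  obtain ⟨e, he⟩ : ∃ e : Fin n → X, Function.Injective e :=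
    ⟨fun k => Infinite.natEmbedding X k,
      fun k l h => Fin.ext ((Infinite.natEmbedding X).injective h)⟩
  let x (k : Fin n ⊕ A) (a : Y) : Generic Θ X m V := Sum.elim a (↑) k
  let E : Set Z := Set.range fun k : Fin n => (x (Sum.inl k) : Z)
  let R₀ : Set (Z × Generic Θ X m V) := Set.range fun z : A => ((x (Sum.inr z) : Z), z.1)
  have hR₀ : IsPartialIso P colour R₀ := by
    refine ⟨?_, fun t ht => ?_⟩
    · rintro _ ⟨z, rfl⟩ _ ⟨z', rfl⟩
      exact hconst_inj
    · choose z hz using ht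
      obtain rfl := funext hz
      obtain ⟨a, ha⟩ := (hP fun k => x (Sum.inr (z k))).exists
      exact ha.symm
  have hβ : ∀ a ∈ R₀, a.2.level < β := by
    rintro _ ⟨z, rfl⟩
    exact hA z z.2
  -- Different coordinates may have the same germ, so one index is chosen for each germ.
  have hinj : Function.Injective fun z : E => (Sum.inr (e z.2.choose) : Label X m V β) := by
    intro z z' h
    have h' := he (Sum.inr.inj h)
    have hz := z.2.choose_spec
    rw [h'] at hz
    exact Subtype.ext (hz.symm.trans z'.2.choose_spec)
  obtain ⟨R, hR, hiso, hE, -⟩ := exists_extend hR₀ hβ E _ hinj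
  choose y hy using hE
  let a' (k : Fin n) := y (x (Sum.inl k) : Z) ⟨k, rfl⟩
  have ha' (k : Fin n ⊕ A) : ((x k : Z), Sum.elim a' (↑) k) ∈ R := by
    rcases k with k | z
    · exact hy _ ⟨k, rfl⟩
    · exact hR ⟨z, rfl⟩
  refine ⟨a', fun s => ?_⟩
  have h₁ : ∀ᶠ a in (U : Filter Y), ∀ k : s, ∀ l : s,
      (x k a = x l a ↔ Sum.elim a' (↑) k.1 = Sum.elim a' (↑) l.1) := by
    refine eventually_all.2 fun k => eventually_all.2 fun l => ?_
    have h : (x k =ᶠ[U] x l) ↔ Sum.elim a' (↑) k.1 = Sum.elim a' (↑) l.1 :=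
      Germ.coe_eq.symm.trans (hiso.eq_iff _ (ha' k) _ (ha' l))
    by_cases hkl : Sum.elim a' (↑) k.1 = Sum.elim a' (↑) l.1
    · filter_upwards [h.2 hkl] with a ha
      exact iff_of_true ha hkl
    · filter_upwards [Ultrafilter.eventually_not.2 fun h' => hkl (h.1 h')] with a ha
      exact iff_of_false ha hkl
  have h₂ : ∀ᶠ a in (U : Filter Y), ∀ t : Fin m → s,
      colour (fun k => x (t k) a) = colour fun k => Sum.elim a' (↑) (t k).1 := by
    refine eventually_all.2 fun t => ?_
    filter_upwards [hP fun k => x (t k)] with a ha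
    exact ha.trans <| hiso.map_eq (fun k => (_, _)) fun k => ha' (t k)
  filter_upwards [h₁, h₂] with a h₁ h₂
  refine ⟨?_, fun t ht => ?_⟩
  · rintro _ ⟨k, hk, rfl⟩ _ ⟨l, hl, rfl⟩
    exact h₁ ⟨k, hk⟩ ⟨l, hl⟩
  · choose k hk hkt using ht
    obtain rfl := funext hkt
    exact h₂ fun l => ⟨k l, hk l⟩

theorem isSaturated [Nonempty V] [Finite V] [Infinite X] [Nonempty Θ] [NoMaxOrder Θ]
    {κ : Cardinal.{u}} (hΘ : ∀ S : Set Θ, Cardinal.mk S < κ → ∃ β, ∀ γ ∈ S, γ < β) :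
    (colourSignature.{u} m V).IsSaturated (Generic Θ X m V) κ := by
  classical
  intro A hA n Γ hΓ
  let D : Type _ := Finset Γ × ℕ
  have hD (d : D) : ∃ a : Fin n → Generic Θ X m V, ∀ φ ∈ d.1,
      (φ.1.value (Sum.elim a ((↑) : A → Generic Θ X m V)) : ℝ) ≤ 1 / (d.2 + 1) := by
    obtain ⟨a, ha⟩ := hΓ ((↑) '' (d.1 : Set Γ)) (by simp) (d.1.finite_toSet.image _)
      (1 / (d.2 + 1)) Nat.one_div_pos_of_nat
    exact ⟨a, fun φ hφ => ha _ ⟨φ, hφ, rfl⟩⟩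
  choose a ha using hD
  let U : Ultrafilter D := Ultrafilter.of atTop
  have hU : (U : Filter D) ≤ atTop := Ultrafilter.of_le _
  obtain ⟨β, hβ⟩ := hΘ (level '' A) (Cardinal.mk_image_le.trans_lt hA)
  obtain ⟨a', ha'⟩ := exists_limit_tuple (fun z hz => hβ _ ⟨z, hz, rfl⟩) (U.map a)
  refine ⟨a', fun φ hφ => ?_⟩
  obtain ⟨s, hs⟩ := BoundedFormula.exists_finset_support (Generic Θ X m V) φ
  refine eq_of_forall_dist_le fun ε hε => ?_
  obtain ⟨N, hN⟩ := exists_nat_one_div_lt hε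
  have h₁ : ∀ᶠ d in (U : Filter D), (⟨φ, hφ⟩ : Γ) ∈ d.1 ∧ N ≤ d.2 := by
    filter_upwards [hU (mem_atTop (({⟨φ, hφ⟩}, N) : D))] with d hd
    exact ⟨hd.1 (Finset.mem_singleton_self _), hd.2⟩
  obtain ⟨d, hd, hiso⟩ := (h₁.and (Ultrafilter.mem_map.1 (ha' s))).exists
  obtain ⟨β', hβ'⟩ : ∃ β', ∀ k ∈ s, (Sum.elim (a d) (↑) k : Generic Θ X m V).level < β' ∧
      (Sum.elim a' (↑) k : Generic Θ X m V).level < β' := by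
    obtain ⟨γ, hγ⟩ := ((s.finite_toSet.image fun k =>
      (Sum.elim (a d) (↑) k : Generic Θ X m V).level).union (s.finite_toSet.image fun k =>
        (Sum.elim a' (↑) k : Generic Θ X m V).level)).bddAbove
    obtain ⟨β', hβ'⟩ := exists_gt γ
    exact ⟨β', fun k hk => ⟨(hγ (Or.inl ⟨k, hk, rfl⟩)).trans_lt hβ',
      (hγ (Or.inr ⟨k, hk, rfl⟩)).trans_lt hβ'⟩⟩
  obtain ⟨σ, hσ, hσ'⟩ := exists_automorphism hiso (β := β') (by
    rintro _ ⟨k, hk, rfl⟩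
    exact hβ' k hk)
  -- An automorphism matches the two tuples on the finite support of `φ`, so the quantifiers in `φ`
  -- need no analysis.
  have h₂ : φ.value (Sum.elim a' (↑)) = φ.value (Sum.elim (a d) (↑)) :=
    (hs _ (σ ∘ Sum.elim (a d) (↑)) (fun k hk => (hσ _ ⟨k, hk, rfl⟩).symm) _).trans
      (Formula.value_automorphism (isAutomorphism hσ') _ φ)
  rw [h₂, Subtype.dist_eq, Real.dist_eq, Set.Icc.coe_zero, sub_zero,
    abs_of_nonneg (φ.value _).2.1]
  refine (ha d _ hd.1).trans (le_trans ?_ hN.le)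
  exact one_div_le_one_div_of_le (by positivity) (by exact_mod_cast Nat.succ_le_succ hd.2)

end Generic

/-! ### The complete theory of a structure -/

namespace MetricSignature

variable (L : MetricSignature.{u}) (M : Type u) [MetricSpace M] [L.Structure M]

/-- The complete theory of a structure. -/
def completeTheory : L.Theory := {φ | Formula.value φ (Empty.elim : Empty → M) = 0}

theorem completeTheory_models : (L.completeTheory M).Models M := fun _ h => h

/-- For each sentence, the distance of its value from its value in `M` is again a sentence and
vanishes in `M`. So every model of the theory gives all sentences the same values as `M`. -/
theorem completeTheory_isComplete : (L.completeTheory M).IsComplete := by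
  have hcons : (L.completeTheory M).IsConsistent := ⟨M, _, _, L.completeTheory_models M⟩
  refine ⟨⟨⟨_, hcons, rfl⟩, ?_⟩, hcons⟩
  rintro _ ⟨T', ⟨N, _, _, hN⟩, rfl⟩ hle φ hφ
  have hNM : (L.completeTheory M).Models N := fun ψ hψ => hle (fun K _ _ hK => hK ψ hψ) N hN
  have h := hNM (Formula.distFrom (fun _ : Fin 1 => φ)
    fun _ => φ.value (Empty.elim : Empty → M)) (Subtype.ext (dist_self _))
  have h' := (Formula.value_distFrom_le_iff _ _ (Empty.elim : Empty → N) le_rfl).1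
    (congrArg Subtype.val h).le 0
  have h'' : φ.value (Empty.elim : Empty → M) = 0 := (dist_le_zero.1 h').symm.trans (hφ N hN)
  intro K _ _ hK
  exact hK φ h''

end MetricSignature

end ContinuousModelTheory

namespace ContinuousModelTheory

open FirstOrder FirstOrder.Language MetricSignature Filter

/-! ### The continuous modelling property implies the embedding Ramsey property -/

theorem Generic.value_colourFormula_comp {m : ℕ} {V : Type} {M : Type v} [MetricSpace M]
    [(colourSignature.{u} m V).Structure M] {α : Type w} (c : V) (t : Fin m → α) (a : α → M) :
    (colourFormula c t : (colourSignature.{u} m V).Formula α).value a =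
      (colourFormula c id : (colourSignature.{u} m V).Formula (Fin m)).value (a ∘ t) := rfl

/-- There are arbitrarily large strong limit cardinals `κ`, and well-orders in which all sets of
size less than `κ` are strictly bounded. -/
theorem exists_isStrongLimit_bounded (c : Cardinal.{u}) :
    ∃ (κ : Cardinal.{u}) (Θ : Type u) (_ : LinearOrder Θ) (_ : WellFoundedLT Θ),
      κ.IsStrongLimit ∧ Cardinal.aleph0 < κ ∧ c < κ ∧
        ∀ S : Set Θ, Cardinal.mk S < κ → ∃ β, ∀ γ ∈ S, γ < β := by
  -- Beth numbers at limit ordinals are strong limits. The well-order is the initial ordinal of the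
  -- successor of `κ`, whose regularity bounds small sets.
  set κ := Cardinal.beth (c.ord + Ordinal.omega0) with hκ
  have hlt : Cardinal.beth c.ord < κ :=
    Cardinal.beth_strictMono (lt_add_of_pos_right _ Ordinal.omega0_pos)
  have hκ₀ : Cardinal.aleph0 < κ := (Cardinal.aleph0_le_beth _).trans_lt hlt
  refine ⟨κ, (Order.succ κ).ord.ToType, inferInstance, inferInstance,
    Cardinal.isStrongLimit_beth.2
      (Ordinal.isSuccLimit_add _ Ordinal.isSuccLimit_omega0).isSuccPrelimit,
    hκ₀, (Cardinal.le_beth_ord c).trans_lt hlt, fun S hS => ?_⟩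
  by_contra! h
  have hcof := Order.cof_le (s := S) h
  rw [Ordinal.cof_toType, (Cardinal.isRegular_succ hκ₀.le).cof_ord] at hcof
  exact absurd (hcof.trans_lt hS) (Order.le_succ κ).not_gt

/-- Every colouring of `m`-tuples embeds into a monster model of a complete theory with one `m`-ary
predicate for every colour. -/
theorem exists_monster_colour (X : Type u) [Infinite X] {m : ℕ} [NeZero m] {V : Type} [Nonempty V]
    [Finite V] [DecidableEq V]
    {Z : Type w} (e : Z → X) (he : Function.Injective e) (P : (Fin m → Z) → V) :
    ∃ (T : (colourSignature.{u} m V).Theory) (κ : Cardinal.{u}) (M : Type u) (_ : MetricSpace M)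
      (_ : (colourSignature.{u} m V).Structure M) (a : Z → M), T.IsComplete ∧ T.IsMonster κ M ∧
      Cardinal.mk X < κ ∧ ∀ (c : V) (t : Fin m → Z),
        (Generic.colourFormula c id : (colourSignature.{u} m V).Formula (Fin m)).value (a ∘ t) =
          if P t = c then 1 else 0 := by
  obtain ⟨κ, Θ, _, _, hκ, hκ₀, hX, hΘ⟩ := exists_isStrongLimit_bounded (Cardinal.mk X)
  have : Nonempty Θ := (hΘ ∅ (by simpa using hκ₀.pos)).nonempty
  have : NoMaxOrder Θ := ⟨fun γ =>
    (hΘ {γ} (by simpa using Cardinal.one_lt_aleph0.trans hκ₀)).imp fun β hβ => hβ γ rfl⟩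
  -- For `m = 0` the empty relation would have to respect the colour of the empty tuple.
  have hempty : IsPartialIso P (Generic.colour (Θ := Θ) (X := X)) ∅ :=
    ⟨by simp, fun t ht => (ht 0).elim⟩
  obtain ⟨R, -, hR, hZ, -⟩ := Generic.exists_extend hempty (β := Classical.arbitrary Θ) (by simp)
    Set.univ
    (fun z => Sum.inr (e z)) (fun z z' h => Subtype.ext (he (Sum.inr.inj h)))
  choose a ha using fun z => hZ z trivial
  refine ⟨_, κ, Generic Θ X m V, _, _, a, completeTheory_isComplete _ (Generic Θ X m V),
    ⟨completeTheory_models _ _, hκ, ?_, Generic.isSaturated hΘ,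
      Generic.isStronglyHomogeneous hκ₀.le hΘ⟩, hX, fun c t => ?_⟩
  · rwa [card_colourSignature]
  · rw [Generic.value_colourFormula]
    have h : P t = Generic.colour ((a ∘ t) ∘ id) :=
      hR.map_eq (fun k => (t k, a (t k))) fun k => ha (t k)
    by_cases hc : P t = c
    · rw [if_pos hc, if_pos (h.symm.trans hc)]
    · rw [if_neg hc, if_neg fun h' => hc (h.trans h')]

/-! ### From a failure of the Ramsey property to a contradiction with modelling. -/

section Ramsey

variable {L' : FirstOrder.Language.{u, v}} {I : Type w} [L'.Structure I]

theorem finite_of_mem_age (hI : IsLocallyFinite L' I) {B : Bundled.{w} L'.Structure}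
    (hB : B ∈ L'.age I) : Finite B := by
  obtain ⟨f⟩ := hB.2
  obtain ⟨S, hS, hS'⟩ := Substructure.fg_def.1 (hB.1.range f.toHom)
  have h := hI S hS
  rw [hS'] at h
  have : Finite (Set.range f) := h
  exact Finite.of_injective_finite_range f.injective

/-- If the embedding Ramsey property fails, then some colouring of the copies of `A` in `I` has no
monochromatic copy of `B`. -/
theorem exists_bad_colouring (hI : IsLocallyFinite L' I) {A B : Bundled.{w} L'.Structure}
    (hA : A ∈ L'.age I) (hB : B ∈ L'.age I) {r : ℕ}
    (h : ∀ C ∈ L'.age I, Nonempty (B ↪[L'] C) → ¬ Arrow L' A B C r) :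
    ∃ χ : (A ↪[L'] I) → Fin r, ∀ f : B ↪[L'] I, ∃ g g' : A ↪[L'] B,
      χ (f.comp g) ≠ χ (f.comp g') := by
  classical
  have := finite_of_mem_age hI hA
  have := finite_of_mem_age hI hB
  have : Finite (A ↪[L'] B) := DFunLike.finite _
  obtain ⟨f₀⟩ := hB.2
  let C (s : Finset I) : L'.Substructure I := Substructure.closure L' (s : Set I)
  have hC (s : Finset I) : (⟨C s, inferInstance⟩ : Bundled.{w} L'.Structure) ∈ L'.age I :=
    age.fg_substructure (Substructure.fg_closure s.finite_toSet)
  have hrange (f : B ↪[L'] I) : ∃ s : Finset I, ∀ s', s ≤ s' → ∀ z, f z ∈ C s' :=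
    ⟨(Set.finite_range f).toFinset, fun s' hs' z =>
      Substructure.subset_closure (hs' ((Set.finite_range f).mem_toFinset.2 ⟨z, rfl⟩))⟩
  obtain ⟨s₀, hs₀⟩ := hrange f₀
  have hbad (s : Finset I) (hs : s₀ ≤ s) : ∃ χ : (A ↪[L'] C s) → Fin r,
      ∀ f : B ↪[L'] C s, ∃ g g' : A ↪[L'] B, χ (f.comp g) ≠ χ (f.comp g') := by
    have h' := h _ (hC s) ⟨f₀.codRestrict (C s) (hs₀ s hs)⟩
    simpa only [Arrow, not_forall, not_exists] using h'
  have hr : Nonempty (Fin r) := by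
    obtain ⟨χ, hχ⟩ := hbad s₀ le_rfl
    obtain ⟨g, -⟩ := hχ (f₀.codRestrict (C s₀) (hs₀ s₀ le_rfl))
    exact ⟨χ ((f₀.codRestrict (C s₀) (hs₀ s₀ le_rfl)).comp g)⟩
  choose! χ hχ using hbad
  -- The default colour is irrelevant in the limit: for a copy of A inside a fixed copy of B, all
  -- large `s` generate a substructure containing it. Finitely many such copies are handled by one
  -- common `s`.
  let col (s : Finset I) (h : A ↪[L'] I) : Fin r :=
    if hs : ∀ z, h z ∈ C s then χ s (h.codRestrict (C s) hs) else Classical.arbitrary _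
  let U : Ultrafilter (Finset I) := Ultrafilter.of atTop
  have hU : (U : Filter (Finset I)) ≤ atTop := Ultrafilter.of_le _
  have hlim (h : A ↪[L'] I) : ∃ c, ∀ᶠ s in (U : Filter (Finset I)), col s h = c :=
    Ultrafilter.eventually_exists_iff.1 (Eventually.of_forall fun s => ⟨_, rfl⟩)
  choose lim hlim using hlim
  refine ⟨lim, fun f => ?_⟩
  obtain ⟨s₁, hs₁⟩ := hrange f
  have hlarge (s' : Finset I) : ∀ᶠ s in (U : Filter (Finset I)), s' ≤ s := hU (mem_atTop s')
  obtain ⟨s, hs₀s, hs₁s, hs⟩ := ((hlarge s₀).and ((hlarge s₁).and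
    (eventually_all.2 fun g : A ↪[L'] B => hlim (f.comp g)))).exists
  obtain ⟨g, g', hgg'⟩ := hχ s hs₀s (f.codRestrict (C s) (hs₁ s hs₁s))
  have hcol (g : A ↪[L'] B) :
      lim (f.comp g) = χ s ((f.codRestrict (C s) (hs₁ s hs₁s)).comp g) :=
    (hs g).symm.trans (dif_pos fun z => hs₁ s hs₁s (g z))
  exact ⟨g, g', by rwa [hcol, hcol]⟩

theorem HasCMP.embeddingRamseyProperty [Infinite I] (hI : IsLocallyFinite L' I)
    (h : HasCMP.{u, v, w, x} L' I) : EmbeddingRamseyProperty L' (L'.age I) := by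
  intro A hA B hB hAB r
  by_contra! hC
  obtain ⟨χ, hχ⟩ := exists_bad_colouring hI hA hB hC
  classical
  have := finite_of_mem_age hI hA
  have := finite_of_mem_age hI hB
  obtain ⟨f₀⟩ := hB.2
  obtain ⟨g₀⟩ := hAB
  have : Nonempty (Fin r) := ⟨χ (f₀.comp g₀)⟩
  obtain ⟨m, ⟨eA⟩⟩ := Finite.exists_equiv_fin A
  -- If A is empty, it has only one embedding into B, and no colouring can be bad.
  have : NeZero m := by
    refine ⟨?_⟩
    rintro rfl
    have := eA.isEmpty
    obtain ⟨g, g', hgg'⟩ := hχ f₀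
    exact hgg' (congrArg _ (DFunLike.ext _ _ isEmptyElim))
  obtain ⟨n, ⟨eB⟩⟩ := Finite.exists_equiv_fin B
  let P (t : Fin m → I) : Fin r :=
    if h : ∃ g : A ↪[L'] I, t = g ∘ eA.symm then χ h.choose else Classical.arbitrary _
  have hP (g : A ↪[L'] I) : P (g ∘ eA.symm) = χ g := by
    have h : ∃ g' : A ↪[L'] I, g ∘ eA.symm = g' ∘ eA.symm := ⟨g, rfl⟩
    simp only [P, dif_pos h]
    congr 1
    exact DFunLike.coe_injective (eA.symm.surjective.injective_comp_right h.choose_spec).symm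
  obtain ⟨T, κ, M, _, _, a, hT, hM, hκ, ha⟩ :=
    exists_monster_colour (ULift.{x} I) ULift.up ULift.up_injective P
  obtain ⟨b, hb, hba⟩ := h _ T hT κ M hM (by rwa [Cardinal.mk_uLift] at hκ) a
  let t (g : A ↪[L'] B) : Fin m → Fin n := eB ∘ g ∘ eA.symm
  let φ (c : Fin r) (g : A ↪[L'] B) :
      (colourSignature.{max w x} m (Fin r)).Formula (Fin n) := Generic.colourFormula c (t g)
  let Φ (s : Fin r × (A ↪[L'] B)) : (colourSignature.{max w x} m (Fin r)).CLFormula M n :=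
    ⟨fun p => (p.1 (φ s.1 s.2) : ℝ), 
      continuous_subtype_val.comp ((continuous_apply _).comp continuous_subtype_val)⟩
  have : Finite (A ↪[L'] B) := DFunLike.finite _
  -- Values along `a` are 0 or 1. Two of them within 1/4 of a common value along `b` differ by at
  -- most 1/2, hence are equal.
  obtain ⟨i, hij, hi⟩ := hba n (Set.range Φ) (Set.finite_range Φ) (f₀ ∘ eB.symm) (1 / 4)
    (by norm_num)
  obtain ⟨f, hf⟩ : ∃ f : B ↪[L'] I, ∀ z, f z = i (eB z) := by
    obtain ⟨g, hg⟩ := hij.symm.exists_embedding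
    have hmem (z : B) : f₀ z ∈ Substructure.closure L' (Set.range (f₀ ∘ eB.symm)) :=
      Substructure.subset_closure ⟨eB z, by simp⟩
    refine ⟨g.comp (f₀.codRestrict _ hmem), fun z => ?_⟩
    rw [← hg (eB z)]
    simp
  obtain ⟨g, g', hgg'⟩ := hχ f
  have hval (c : Fin r) (g : A ↪[L'] B) :
      (φ c g).value (a ∘ i) = if χ (f.comp g) = c then 1 else 0 := by
    have h : i ∘ t g = f.comp g ∘ eA.symm := funext fun k => (hf _).symm
    rw [Generic.value_colourFormula_comp, Function.comp_assoc, ha, h, hP]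
  have hbval (c : Fin r) (g : A ↪[L'] B) : (φ c g).value (b ∘ f₀ ∘ eB.symm) =
      (Generic.colourFormula c id : (colourSignature.{max w x} m (Fin r)).Formula (Fin m)).value
        (b ∘ (f₀.comp g ∘ eA.symm)) := by
    have h : (f₀ ∘ eB.symm) ∘ t g = f₀.comp g ∘ eA.symm := funext fun k => by simp [t]
    rw [Generic.value_colourFormula_comp, Function.comp_assoc, h]
  -- Any two copies of A inside `f₀` have the same quantifier-free type, so indiscernibility gives
  -- them equal colour values along `b`.
  have hind (c : Fin r) :
      (φ c g).value (b ∘ f₀ ∘ eB.symm) = (φ c g').value (b ∘ f₀ ∘ eB.symm) := by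
    rw [hbval, hbval]
    refine congrFun (hb m _ _ ?_) (Generic.colourFormula c id)
    exact (sameQFType_embedding_comp (f₀.comp g) _).trans
      (sameQFType_embedding_comp (f₀.comp g') _).symm
  have h₁ : |((φ (χ (f.comp g)) g).value (b ∘ f₀ ∘ eB.symm) : ℝ) -
      (φ (χ (f.comp g)) g).value (a ∘ i)| ≤ 1 / 4 := hi _ ⟨(_, _), rfl⟩
  have h₂ : |((φ (χ (f.comp g)) g').value (b ∘ f₀ ∘ eB.symm) : ℝ) -
      (φ (χ (f.comp g)) g').value (a ∘ i)| ≤ 1 / 4 := hi _ ⟨(_, _), rfl⟩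
  rw [hval, if_pos rfl, hind, Set.Icc.coe_one, abs_le] at h₁
  rw [hval, if_neg hgg'.symm, Set.Icc.coe_zero, abs_le] at h₂
  linarith [h₁.1, h₂.2]

end Ramsey

end ContinuousModelTheory

theorem mainTheorem6 (L' : FirstOrder.Language.{u, v}) (I : Type w) [L'.Structure I] [Infinite I]
    (hI : ContinuousModelTheory.IsLocallyFinite L' I) :
    ContinuousModelTheory.EmbeddingRamseyProperty L' (L'.age I) ↔
      ContinuousModelTheory.HasCMP.{u, v, w, x} L' I :=
  ⟨fun h => h.hasCMP, fun h => h.embeddingRamseyProperty hI⟩
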